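/- Let $m>1$, $0<p<1$ with $m+p>2$, let $\sigma>2(1-p)/(m-1)$, and set $$\alpha=\frac{\sigma+2}{\sigma(m-1)+2(p-1)}>0,\qquad \beta=\frac{m-p}{\sigma(m-1)+2(p-1)}>0 .$$ For $a\ge 0$, a \emph{profile} on $(a,\infty)$ is a continuous function $f:(a,\infty)\to[0,\infty)$ such that $f^m\in C^1((a,\infty))$ and, at every point $\xi>a$ with $f(\xi)>0$, $f$ is differentiable, $f^m$ is twice differentiable, and $$(f^m)''(\xi)-\alpha f(\xi)+\beta\xi f'(\xi)+\xi^{\sigma}f(\xi)^{p}=0 .$$ (No condition is imposed at the left endpoint.) A profile $f$ on $(a,\infty)$ has an \emph{interface of Type I} at $\xi_0>a$ if $f(\xi_0)=0$, $(f^m)'(\xi_0)=0$, $f>0$ on $(\xi_0-\delta,\xi_0)$ for some $\delta>0$, and there is a constant $C>0$ such that $$\lim_{\xi\to\xi_0^-}\frac{f(\xi)}{(\xi_0-\xi)^{1/(m-1)}}=C .$$ Proposition 3.7. For every $\xi_0\in(0,\infty)$ there is exactly one profile having an interface of Type I at $\xi_0$, in the following sense: there exist $a\in[0,\xi_0)$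 and a profile $f$ on $(a,\infty)$ with an interface of Type I at $\xi_0$ such that, whenever $b\in[0,\xi_0)$ and $g$ is a profile on $(b,\infty)$ with an interface of Type I at $\xi_0$, one has $a\le b$ and $g=f$ on $(b,\infty)$. -/

import Mathlib

open Set Filter Topology

noncomputable section

namespace BlowUpProfile

/-- The self-similarity exponent `α = (σ + 2) / (σ (m - 1) + 2 (p - 1))`. -/
def alpha (m p σ : ℝ) : ℝ := (σ + 2) / (σ * (m - 1) + 2 * (p - 1))

/-- The self-similarity exponent `β = (m - p) / (σ (m - 1) + 2 (p - 1))`. -/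
def beta (m p σ : ℝ) : ℝ := (m - p) / (σ * (m - 1) + 2 * (p - 1))

/-- `f` is a (nonnegative) profile on `(a, ∞)`, i.e. a solution there of
`(f^m)'' - α f + β ξ f' + ξ^σ f^p = 0`.

As usual for this degenerate equation, `f` is continuous and nonnegative, the flux `(f^m)'` exists
and is continuous everywhere (also at the zeros of `f`), and the equation holds in the classical
sense at all points where `f` is positive. (At a zero of `f`, the function `f` itself need not be
differentiable: this is the case at an interface.) Since `f^m ≥ 0` has vanishing derivative at
its zeros, this is the same as being a weak solution. No condition is imposed at the left end of
the interval, so that both good and other profiles are covered. -/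
structure IsProfile (m p σ a : ℝ) (f : ℝ → ℝ) : Prop where
  nonneg : ∀ ξ ∈ Ioi a, 0 ≤ f ξ
  continuousOn : ContinuousOn f (Ioi a)
  contDiffOn_pow : ContDiffOn ℝ 1 (fun s => f s ^ m) (Ioi a)
  differentiableAt : ∀ ξ ∈ Ioi a, 0 < f ξ → DifferentiableAt ℝ f ξ
  differentiableAt_flux : ∀ ξ ∈ Ioi a, 0 < f ξ →
    DifferentiableAt ℝ (deriv (fun s => f s ^ m)) ξ
  equation : ∀ ξ ∈ Ioi a, 0 < f ξ →
    deriv (deriv (fun s => f s ^ m)) ξ - alpha m p σ * f ξ + beta m p σ * ξ * deriv f ξ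
      + ξ ^ σ * f ξ ^ p = 0

/-- `f` has an interface at `ξ₀`: `f(ξ₀) = 0`, `(f^m)'(ξ₀) = 0` and `f > 0` on some
`(ξ₀ - δ, ξ₀)`. -/
structure HasInterface (m : ℝ) (f : ℝ → ℝ) (ξ₀ : ℝ) : Prop where
  eq_zero : f ξ₀ = 0
  flux_eq_zero : HasDerivAt (fun s => f s ^ m) 0 ξ₀
  pos_left : ∃ δ > 0, ∀ ξ ∈ Ioo (ξ₀ - δ) ξ₀, 0 < f ξ

/-- `f` has an interface of Type I at `ξ₀`: an interface where `f(ξ)` behaves, up to a positive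
multiplicative constant, like `(ξ₀ - ξ)^{1/(m-1)}` as `ξ → ξ₀` from the left. -/
structure HasTypeIInterface (m : ℝ) (f : ℝ → ℝ) (ξ₀ : ℝ) : Prop where
  hasInterface : HasInterface m f ξ₀
  behavior : ∃ C > 0,
    Asymptotics.IsEquivalent (𝓝[<] ξ₀) f (fun ξ => C * (ξ₀ - ξ) ^ (1 / (m - 1)))

end BlowUpProfile

end

/-!
A profile never leaves zero once it has reached it: to the right of a last zero the function
`(f^m)' + β ξ f`, whose derivative is `(α + β) f - ξ^σ f^p`, becomes negative because `p < 1`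
makes the reaction dominate for small `f`, and then `f^m` would decrease below zero
(`IsProfile.eq_zero_of_le`). Hence a profile with an interface at `ξ₀` vanishes to the right of `ξ₀`
and is positive everywhere to its left, where the equation is regular and backward uniqueness is
that of a locally Lipschitz system (`IsProfile.eqOn_Icc`).

What remains is the singular point itself. With `x = ξ₀ - ξ`, write the pressure
`m / (m - 1) * f^(m - 1)` as `x * w x`. A Type I interface means that `w` has a positive limit at
`0`, and the equation integrated from the interface, where the flux vanishes, reads
`(x * w x)' = β (ξ₀ - x) + (1 / f) ∫₀ˣ ((α + β) f - ξ^σ f^p)`, with the factor `1 / f` evaluated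
at `ξ₀ - x`. Averaged over `[0, x]` this is a fixed-point equation `w = meanSlope (kernel …) w`,
with no singularity at `x = 0`: the integral terms carry the factors `x` and
`x^(1 - (1 - p) / (m - 1))`, and the second exponent is positive because `m + p > 2`. For `w`
between two positive constants and `x` small, the right-hand side is therefore a contraction close
to the constant `β ξ₀` (`exists_kernel_estimates`). Its fixed point yields a profile near `ξ₀`
(`exists_isProfile`), and the rescaled pressures of two given profiles are both fixed points
(`IsProfile.exists_rescaledPressure`), so they coincide near `ξ₀`.

Consequently any two profiles with a Type I interface at `ξ₀` agree wherever both are defined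
(`IsProfile.eqOn_Ioi`). The maximal profile is the union of all of them, defined on `(a, ∞)` with
`a` the infimum of their left endpoints; no continuation argument is needed.
-/

open Set Filter Topology

noncomputable section

namespace BlowUpProfile

/-! ### A doubly averaged fixed-point equation -/

/-- The average over `t ∈ [0, 1]` of `H y t (w y) (w (t y))`. In the application this is the
derivative, at distance `y` from the interface, of the pressure `y * w y`. -/
def slope (H : ℝ → ℝ → ℝ → ℝ → ℝ) (w : ℝ → ℝ) (y : ℝ) : ℝ :=
  ∫ t in (0 : ℝ)..1, H y t (w y) (w (t * y))

/-- The mean value of `slope H w` over `[0, x]`, written in a form that makes sense at `x = 0`. -/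
def meanSlope (H : ℝ → ℝ → ℝ → ℝ → ℝ) (w : ℝ → ℝ) (x : ℝ) : ℝ :=
  ∫ s in (0 : ℝ)..1, slope H w (s * x)

section FixedPoint

variable {H : ℝ → ℝ → ℝ → ℝ → ℝ} {w w' : ℝ → ℝ} {δ D : ℝ}

theorem continuous_slope_integrand
    (hH : Continuous fun z : ℝ × ℝ × ℝ × ℝ => H z.1 z.2.1 z.2.2.1 z.2.2.2) (hw : Continuous w) :
    Continuous (Function.uncurry fun y t : ℝ => H y t (w y) (w (t * y))) := by
  have : Continuous fun z : ℝ × ℝ => ((z.1, z.2, w z.1, w (z.2 * z.1)) : ℝ × ℝ × ℝ × ℝ) := by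
    fun_prop
  exact hH.comp this

theorem continuous_slope
    (hH : Continuous fun z : ℝ × ℝ × ℝ × ℝ => H z.1 z.2.1 z.2.2.1 z.2.2.2) (hw : Continuous w) :
    Continuous (slope H w) :=
  intervalIntegral.continuous_parametric_intervalIntegral_of_continuous'
    (continuous_slope_integrand hH hw) 0 1

theorem continuous_meanSlope
    (hH : Continuous fun z : ℝ × ℝ × ℝ × ℝ => H z.1 z.2.1 z.2.2.1 z.2.2.2) (hw : Continuous w) :
    Continuous (meanSlope H w) := by
  refine intervalIntegral.continuous_parametric_intervalIntegral_of_continuous'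
    (f := fun x s => slope H w (s * x)) ?_ 0 1
  exact (continuous_slope hH hw).comp (by fun_prop : Continuous fun z : ℝ × ℝ => z.2 * z.1)

theorem mul_meanSlope (x : ℝ) : x * meanSlope H w x = ∫ y in (0 : ℝ)..x, slope H w y := by
  simp [meanSlope, intervalIntegral.mul_integral_comp_mul_right]

theorem mul_mem_Icc_of_mem {s x : ℝ} (hs : s ∈ Icc (0 : ℝ) 1) (hx : x ∈ Icc 0 δ) :
    s * x ∈ Icc 0 δ :=
  ⟨mul_nonneg hs.1 hx.1, (mul_le_of_le_one_left hx.1 hs.2).trans hx.2⟩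

theorem abs_integral_sub_le {u v : ℝ → ℝ} (hu : Continuous u) (hv : Continuous v)
    (h : ∀ t ∈ Icc (0 : ℝ) 1, |u t - v t| ≤ D) :
    |(∫ t in (0 : ℝ)..1, u t) - ∫ t in (0 : ℝ)..1, v t| ≤ D := by
  rw [← intervalIntegral.integral_sub (hu.intervalIntegrable _ _) (hv.intervalIntegrable _ _)]
  have := intervalIntegral.norm_integral_le_of_norm_le_const (a := 0) (b := 1) (C := D)
    (f := fun t => u t - v t) fun t ht => by
      rw [uIoc_of_le zero_le_one] at ht
      exact h t ⟨ht.1.le, ht.2⟩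
  simpa using this

/-- If `H` is `1/2`-Lipschitz in its last two arguments, then `meanSlope H` is a contraction for the
uniform distance on `[0, δ]`. -/
theorem abs_meanSlope_sub_le
    (hH : Continuous fun z : ℝ × ℝ × ℝ × ℝ => H z.1 z.2.1 z.2.2.1 z.2.2.2)
    (hLip : ∀ y ∈ Icc 0 δ, ∀ t ∈ Icc (0 : ℝ) 1, ∀ A A' B B' D : ℝ, |A - A'| ≤ D → |B - B'| ≤ D →
      |H y t A B - H y t A' B'| ≤ D / 2)
    (hw : Continuous w) (hw' : Continuous w') (hD : ∀ x ∈ Icc 0 δ, |w x - w' x| ≤ D)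
    {x : ℝ} (hx : x ∈ Icc 0 δ) :
    |meanSlope H w x - meanSlope H w' x| ≤ D / 2 := by
  refine abs_integral_sub_le ((continuous_slope hH hw).comp (continuous_mul_const x))
    ((continuous_slope hH hw').comp (continuous_mul_const x)) fun s hs => ?_
  have hsx := mul_mem_Icc_of_mem hs hx
  refine abs_integral_sub_le
    ((continuous_slope_integrand hH hw).comp (Continuous.prodMk_right (s * x)))
    ((continuous_slope_integrand hH hw').comp (Continuous.prodMk_right (s * x))) fun t ht => ?_
  exact hLip _ hsx t ht _ _ _ _ D (hD _ hsx) (hD _ (mul_mem_Icc_of_mem ht hsx))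

theorem eqOn_of_eq_meanSlope
    (hH : Continuous fun z : ℝ × ℝ × ℝ × ℝ => H z.1 z.2.1 z.2.2.1 z.2.2.2) (hδ : 0 ≤ δ)
    (hLip : ∀ y ∈ Icc 0 δ, ∀ t ∈ Icc (0 : ℝ) 1, ∀ A A' B B' D : ℝ, |A - A'| ≤ D → |B - B'| ≤ D →
      |H y t A B - H y t A' B'| ≤ D / 2)
    (hw : Continuous w) (hw' : Continuous w') (h : ∀ x ∈ Icc 0 δ, w x = meanSlope H w x)
    (h' : ∀ x ∈ Icc 0 δ, w' x = meanSlope H w' x) : EqOn w w' (Icc 0 δ) := by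
  obtain ⟨x₀, hx₀, hmax⟩ := isCompact_Icc.exists_isMaxOn (nonempty_Icc.2 hδ)
    (hw.sub hw').abs.continuousOn
  have key := abs_meanSlope_sub_le hH hLip hw hw' (D := |w x₀ - w' x₀|)
    (fun x hx => hmax hx) hx₀
  rw [← h _ hx₀, ← h' _ hx₀] at key
  intro x hx
  have h1 : |w x - w' x| ≤ |w x₀ - w' x₀| := hmax hx
  have h2 := abs_nonneg (w x₀ - w' x₀)
  exact sub_eq_zero.1 (abs_eq_zero.1 (le_antisymm (by linarith) (abs_nonneg _)))

theorem exists_eq_meanSlope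
    (hH : Continuous fun z : ℝ × ℝ × ℝ × ℝ => H z.1 z.2.1 z.2.2.1 z.2.2.2) (hδ : 0 ≤ δ)
    (hLip : ∀ y ∈ Icc 0 δ, ∀ t ∈ Icc (0 : ℝ) 1, ∀ A A' B B' D : ℝ, |A - A'| ≤ D → |B - B'| ≤ D →
      |H y t A B - H y t A' B'| ≤ D / 2) :
    ∃ w : ℝ → ℝ, Continuous w ∧ ∀ x ∈ Icc 0 δ, w x = meanSlope H w x := by
  have hext (u : C(Icc (0 : ℝ) δ, ℝ)) : Continuous (IccExtend hδ u) := u.continuous.Icc_extend'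
  let T : C(Icc (0 : ℝ) δ, ℝ) → C(Icc (0 : ℝ) δ, ℝ) := fun u =>
    ⟨fun x => meanSlope H (IccExtend hδ u) x,
      (continuous_meanSlope hH (hext u)).comp continuous_subtype_val⟩
  have hT : ContractingWith (1 / 2) T := by
    refine ⟨by norm_num [← NNReal.coe_lt_coe], LipschitzWith.of_dist_le_mul fun u v => ?_⟩
    rw [ContinuousMap.dist_le (by positivity)]
    intro x
    have := abs_meanSlope_sub_le hH hLip (hext u) (hext v) (D := dist u v) (fun y hy => by
      rw [IccExtend_of_mem _ _ hy, IccExtend_of_mem _ _ hy]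
      exact ContinuousMap.dist_apply_le_dist (f := u) (g := v) _) x.2
    rw [Real.dist_eq]
    refine this.trans (le_of_eq ?_)
    push_cast
    ring
  refine ⟨IccExtend hδ hT.fixedPoint, hext _, fun x hx => ?_⟩
  have h : T hT.fixedPoint = hT.fixedPoint := hT.fixedPoint_isFixedPt
  rw [IccExtend_of_mem _ _ hx]
  exact (DFunLike.congr_fun h ⟨x, hx⟩).symm

end FixedPoint

/-! ### The kernel of the rescaled pressure equation -/

/-- The value of a profile at distance `x` from its interface, expressed by the quotient
`A = m / (m - 1) * f ^ (m - 1) / x` of its pressure by that distance. -/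
def ofPressure (m x A : ℝ) : ℝ := ((m - 1) / m * x * A) ^ (1 / (m - 1))

/-- The exponent `1 - (1 - p) / (m - 1)` of the distance to the interface in the reaction term.
It is positive exactly when `m + p > 2`. -/
def reactionExp (m p : ℝ) : ℝ := 1 + p * (1 / (m - 1)) - 1 / (m - 1)

/-- The integrand of the rescaled pressure equation: a profile with an interface at `ξ₀` is
`ofPressure m x (w x)` at `ξ₀ - x`, where `x * w x` has derivative `slope (kernel m p σ ξ₀) w x`.
Both terms after the first are `ofPressure`-quotients with the powers of `y` collected, so that
they make sense, and vanish, at `y = 0`. -/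
def kernel (m p σ ξ₀ y t A B : ℝ) : ℝ :=
  beta m p σ * (ξ₀ - y)
    + (alpha m p σ + beta m p σ) * (y * t ^ (1 / (m - 1)))
        * (B ^ (1 / (m - 1)) * A ^ (-(1 / (m - 1))))
    - ((m - 1) / m) ^ ((p - 1) * (1 / (m - 1)))
        * (y ^ reactionExp m p * t ^ (p * (1 / (m - 1))) * (ξ₀ - t * y) ^ σ)
        * (B ^ (p * (1 / (m - 1))) * A ^ (-(1 / (m - 1))))

section Kernel

variable {m p σ ξ₀ : ℝ}

theorem reactionExp_pos (hm : 1 < m) (hmp : 2 < m + p) : 0 < reactionExp m p := by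
  have h : 0 < m - 1 := by linarith
  have : reactionExp m p = (m + p - 2) / (m - 1) := by
    unfold reactionExp
    field_simp
    ring
  rw [this]
  exact div_pos (by linarith) h

theorem ofPressure_pos (hm : 1 < m) {x A : ℝ} (hx : 0 < x) (hA : 0 < A) :
    0 < ofPressure m x A := by
  have h : 0 < m - 1 := by linarith
  have h' : 0 < m := by linarith
  unfold ofPressure
  positivity

theorem ofPressure_eq (hm : 1 < m) {x A : ℝ} (hx : 0 ≤ x) (hA : 0 ≤ A) :
    ofPressure m x A
      = ((m - 1) / m) ^ (1 / (m - 1)) * x ^ (1 / (m - 1)) * A ^ (1 / (m - 1)) := by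
  have h : 0 ≤ (m - 1) / m := div_nonneg (by linarith) (by linarith)
  rw [ofPressure, Real.mul_rpow (by positivity) hA, Real.mul_rpow h hx]

/-- The kernel expressed through the values of the profile. -/
theorem ofPressure_mul_kernel (hm : 1 < m) {y t A B : ℝ} (hy : 0 < y) (ht : 0 ≤ t) (hA : 0 < A)
    (hB : 0 ≤ B) :
    ofPressure m y A * kernel m p σ ξ₀ y t A B
      = beta m p σ * (ξ₀ - y) * ofPressure m y A
        + y * ((alpha m p σ + beta m p σ) * ofPressure m (t * y) B
          - (ξ₀ - t * y) ^ σ * ofPressure m (t * y) B ^ p) := by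
  have hk : 0 < (m - 1) / m := div_pos (by linarith) (by linarith)
  have hty : 0 ≤ t * y := by positivity
  rw [ofPressure_eq hm hy.le hA.le, ofPressure_eq hm hty hB, kernel, reactionExp]
  generalize (m - 1) / m = k at *
  generalize 1 / (m - 1) = q at *
  rw [Real.mul_rpow ht hy.le, Real.mul_rpow (y := B ^ q) (by positivity) (by positivity),
    Real.mul_rpow (x := k ^ q) (by positivity) (by positivity),
    Real.mul_rpow (x := t ^ q) (by positivity) (by positivity), ← Real.rpow_mul hk.le,
    ← Real.rpow_mul hB, ← Real.rpow_mul ht, ← Real.rpow_mul hy.le, Real.rpow_neg hA.le,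
    Real.rpow_sub hy, Real.rpow_add hy, Real.rpow_one, sub_mul, one_mul, Real.rpow_sub hk,
    mul_comm q p]
  have h1 := (Real.rpow_pos_of_pos hA q).ne'
  have h2 := (Real.rpow_pos_of_pos hk q).ne'
  have h3 := (Real.rpow_pos_of_pos hy q).ne'
  field_simp
  ring

/-- For a positive rescaled pressure `w`, the identity that turns the integrated profile equation
into the rescaled pressure equation. -/
theorem ofPressure_mul_slope (hm : 1 < m) (hp : 0 < p) (hσ : 0 < σ) {w : ℝ → ℝ} {δ x : ℝ}
    (hw : Continuous w) (hpos : ∀ x ∈ Icc 0 δ, 0 < w x) (hx : x ∈ Ioc 0 δ) :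
    ofPressure m x (w x) * slope (kernel m p σ ξ₀) w x
      = beta m p σ * (ξ₀ - x) * ofPressure m x (w x)
        + ∫ y in (0 : ℝ)..x, ((alpha m p σ + beta m p σ) * ofPressure m y (w y)
          - (ξ₀ - y) ^ σ * ofPressure m y (w y) ^ p) := by
  have hq : 0 ≤ 1 / (m - 1) := one_div_nonneg.2 (by linarith)
  have hof : Continuous fun y => ofPressure m y (w y) := by
    unfold ofPressure
    exact ((continuous_const.mul continuous_id).mul hw).rpow_const fun _ => Or.inr hq
  have hcont : Continuous fun y => (alpha m p σ + beta m p σ) * ofPressure m y (w y)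
      - (ξ₀ - y) ^ σ * ofPressure m y (w y) ^ p :=
    (continuous_const.mul hof).sub
      (((continuous_const.sub continuous_id).rpow_const fun _ => Or.inr hσ.le).mul
        (hof.rpow_const fun _ => Or.inr hp.le))
  have hresc := intervalIntegral.mul_integral_comp_mul_right (a := 0) (b := 1)
    (f := fun y => (alpha m p σ + beta m p σ) * ofPressure m y (w y)
      - (ξ₀ - y) ^ σ * ofPressure m y (w y) ^ p) x
  rw [zero_mul, one_mul] at hresc
  rw [← hresc, slope, ← intervalIntegral.integral_const_mul, ← intervalIntegral.integral_const_mul]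
  have hxδ : x ∈ Icc 0 δ := ⟨hx.1.le, hx.2⟩
  have hc : (∫ _t in (0 : ℝ)..1, beta m p σ * (ξ₀ - x) * ofPressure m x (w x))
      = beta m p σ * (ξ₀ - x) * ofPressure m x (w x) := by simp
  have hint : IntervalIntegrable (fun t => x * ((alpha m p σ + beta m p σ)
      * ofPressure m (t * x) (w (t * x)) - (ξ₀ - t * x) ^ σ * ofPressure m (t * x) (w (t * x)) ^ p))
      MeasureTheory.volume 0 1 :=
    (continuous_const.mul (hcont.comp (continuous_mul_const x))).intervalIntegrable 0 1
  rw [← hc, ← intervalIntegral.integral_add (by simp) hint]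
  refine intervalIntegral.integral_congr fun t ht => ?_
  rw [uIcc_of_le zero_le_one] at ht
  exact ofPressure_mul_kernel hm hx.1 ht.1 (hpos x hxδ) (hpos _ (mul_mem_Icc_of_mem ht hxδ)).le

/-- Truncation of a real number to the interval `[lo, hi]`. -/
def truncate (lo hi A : ℝ) : ℝ := max lo (min A hi)

theorem truncate_mem {lo hi : ℝ} (h : lo ≤ hi) (A : ℝ) : truncate lo hi A ∈ Icc lo hi :=
  ⟨le_max_left _ _, max_le h (min_le_right _ _)⟩

theorem truncate_of_mem {lo hi A : ℝ} (h : A ∈ Icc lo hi) : truncate lo hi A = A := by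
  rw [truncate, min_eq_left h.2, max_eq_right h.1]

theorem continuous_truncate {lo hi : ℝ} : Continuous (truncate lo hi) := by
  unfold truncate
  fun_prop

theorem abs_truncate_sub_le (lo hi A A' : ℝ) :
    |truncate lo hi A - truncate lo hi A'| ≤ |A - A'| := by
  unfold truncate
  refine (abs_max_sub_max_le_max _ _ _ _).trans (max_le (by simp) ?_)
  refine (abs_min_sub_min_le_max _ _ _ _).trans (max_le le_rfl (by simp))

/-- The kernel with its last two arguments truncated to `[lo, hi]`; this makes it continuous
everywhere, and globally Lipschitz in these arguments. -/
def truncKernel (m p σ ξ₀ lo hi y t A B : ℝ) : ℝ :=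
  kernel m p σ ξ₀ y t (truncate lo hi A) (truncate lo hi B)

theorem continuous_truncKernel (hm : 1 < m) (hp : 0 < p) (hmp : 2 < m + p) (hσ : 0 < σ)
    {lo hi : ℝ} (hlo : 0 < lo) (hle : lo ≤ hi) :
    Continuous fun z : ℝ × ℝ × ℝ × ℝ =>
      truncKernel m p σ ξ₀ lo hi z.1 z.2.1 z.2.2.1 z.2.2.2 := by
  have hq : 0 ≤ 1 / (m - 1) := one_div_nonneg.2 (by linarith)
  have hpq : 0 ≤ p * (1 / (m - 1)) := by positivity
  have hg := (reactionExp_pos hm hmp).le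
  have hA : Continuous fun z : ℝ × ℝ × ℝ × ℝ => truncate lo hi z.2.2.1 :=
    continuous_truncate.comp (by fun_prop)
  have hB : Continuous fun z : ℝ × ℝ × ℝ × ℝ => truncate lo hi z.2.2.2 :=
    continuous_truncate.comp (by fun_prop)
  have hA' : Continuous fun z : ℝ × ℝ × ℝ × ℝ => truncate lo hi z.2.2.1 ^ (-(1 / (m - 1))) :=
    hA.rpow_const fun z => Or.inl (hlo.trans_le (truncate_mem hle _).1).ne'
  have h1 := hB.rpow_const fun z => Or.inr hq
  have h2 := hB.rpow_const fun z => Or.inr hpq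
  have h3 : Continuous fun z : ℝ × ℝ × ℝ × ℝ => z.1 ^ reactionExp m p :=
    continuous_fst.rpow_const fun z => Or.inr hg
  have h4 : Continuous fun z : ℝ × ℝ × ℝ × ℝ => z.2.1 ^ (1 / (m - 1)) :=
    (by fun_prop : Continuous fun z : ℝ × ℝ × ℝ × ℝ => z.2.1).rpow_const fun z => Or.inr hq
  have h5 : Continuous fun z : ℝ × ℝ × ℝ × ℝ => z.2.1 ^ (p * (1 / (m - 1))) :=
    (by fun_prop : Continuous fun z : ℝ × ℝ × ℝ × ℝ => z.2.1).rpow_const fun z => Or.inr hpq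
  have h6 : Continuous fun z : ℝ × ℝ × ℝ × ℝ => (ξ₀ - z.2.1 * z.1) ^ σ :=
    (by fun_prop : Continuous fun z : ℝ × ℝ × ℝ × ℝ => ξ₀ - z.2.1 * z.1).rpow_const
      fun z => Or.inr hσ.le
  unfold truncKernel kernel
  exact ((continuous_const.mul (continuous_const.sub continuous_fst)).add
    ((continuous_const.mul (continuous_fst.mul h4)).mul (h1.mul hA'))).sub
    ((continuous_const.mul ((h3.mul h5).mul h6)).mul (h2.mul hA'))

theorem exists_lipschitz_rpow_mul_rpow {lo hi : ℝ} (hlo : 0 < lo) (r s : ℝ) :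
    ∃ K : ℝ, 0 ≤ K ∧ (∀ A ∈ Icc lo hi, ∀ B ∈ Icc lo hi, |B ^ r * A ^ s| ≤ K) ∧
      ∀ A ∈ Icc lo hi, ∀ A' ∈ Icc lo hi, ∀ B ∈ Icc lo hi, ∀ B' ∈ Icc lo hi, ∀ D : ℝ,
        |A - A'| ≤ D → |B - B'| ≤ D → |B ^ r * A ^ s - B' ^ r * A' ^ s| ≤ K * D := by
  have hS : IsCompact (Icc lo hi ×ˢ Icc lo hi) := isCompact_Icc.prod isCompact_Icc
  have hC : ContDiffOn ℝ 1 (fun z : ℝ × ℝ => z.2 ^ r * z.1 ^ s) (Icc lo hi ×ˢ Icc lo hi) := by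
    refine (contDiff_snd.contDiffOn.rpow_const_of_ne fun z hz => ?_).mul
      (contDiff_fst.contDiffOn.rpow_const_of_ne fun z hz => ?_)
    · exact (hlo.trans_le hz.2.1).ne'
    · exact (hlo.trans_le hz.1.1).ne'
  obtain ⟨K, hK⟩ := hC.exists_lipschitzOnWith one_ne_zero
    ((convex_Icc lo hi).prod (convex_Icc lo hi)) hS
  obtain ⟨M, hM⟩ := hS.exists_bound_of_continuousOn hC.continuousOn
  refine ⟨max K M, K.2.trans (le_max_left _ _), fun A hA B hB => ?_, ?_⟩
  · exact (hM (A, B) ⟨hA, hB⟩).trans (le_max_right _ _)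
  · intro A hA A' hA' B hB B' hB' D hAD hBD
    have h := hK.dist_le_mul (A, B) ⟨hA, hB⟩ (A', B') ⟨hA', hB'⟩
    rw [Real.dist_eq, Prod.dist_eq] at h
    have hD : 0 ≤ D := (abs_nonneg _).trans hAD
    calc _ ≤ (K : ℝ) * D := h.trans (mul_le_mul_of_nonneg_left (max_le hAD hBD) K.2)
      _ ≤ _ := mul_le_mul_of_nonneg_right (le_max_left _ _) hD

/-- Close to the interface the kernel is a small Lipschitz perturbation of the constant
`β ξ₀`. -/
theorem exists_kernel_estimates (hm : 1 < m) (hp : 0 < p) (hmp : 2 < m + p) (hσ : 0 < σ)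
    (hξ₀ : 0 < ξ₀) {lo hi ε : ℝ} (hlo : 0 < lo) (hε : 0 < ε) :
    ∃ δ₀ > 0, δ₀ ≤ ξ₀ ∧ ∀ y ∈ Icc 0 δ₀, ∀ t ∈ Icc (0 : ℝ) 1, ∀ A ∈ Icc lo hi, ∀ B ∈ Icc lo hi,
      |kernel m p σ ξ₀ y t A B - beta m p σ * ξ₀| ≤ ε ∧
      ∀ A' ∈ Icc lo hi, ∀ B' ∈ Icc lo hi, ∀ D : ℝ, |A - A'| ≤ D → |B - B'| ≤ D →
        |kernel m p σ ξ₀ y t A B - kernel m p σ ξ₀ y t A' B'| ≤ D / 2 := by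
  have hq : 0 ≤ 1 / (m - 1) := one_div_nonneg.2 (by linarith)
  have hpq : 0 ≤ p * (1 / (m - 1)) := by positivity
  have hg := reactionExp_pos hm hmp
  obtain ⟨K₁, hK₁, hb₁, hl₁⟩ := exists_lipschitz_rpow_mul_rpow (hi := hi) hlo (1 / (m - 1))
    (-(1 / (m - 1)))
  obtain ⟨K₂, hK₂, hb₂, hl₂⟩ := exists_lipschitz_rpow_mul_rpow (hi := hi) hlo (p * (1 / (m - 1)))
    (-(1 / (m - 1)))
  set a := |alpha m p σ + beta m p σ| with ha
  set c := ((m - 1) / m) ^ ((p - 1) * (1 / (m - 1))) with hc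
  have ha0 : 0 ≤ a := abs_nonneg _
  have hc0 : 0 ≤ c := Real.rpow_nonneg (div_nonneg (by linarith) (by linarith)) _
  -- the sum of the moduli of the two perturbation terms
  let E : ℝ → ℝ := fun y => a * y * K₁ + c * (y ^ reactionExp m p * ξ₀ ^ σ) * K₂
  let E' : ℝ → ℝ := fun y => |beta m p σ| * y + E y
  have hEc : Continuous E :=
    ((continuous_const.mul continuous_id).mul continuous_const).add
      ((continuous_const.mul ((Real.continuous_rpow_const hg.le).mul continuous_const)).mul
        continuous_const)
  have hE'c : Continuous E' := (continuous_const.mul continuous_id).add hEc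
  have hE0 : E 0 = 0 := by simp [E, Real.zero_rpow hg.ne']
  have hE'0 : E' 0 = 0 := by simp [E', hE0]
  have hev : ∀ᶠ y in 𝓝 (0 : ℝ), E y < 1 / 2 ∧ E' y < ε ∧ y < ξ₀ :=
    (hEc.continuousAt.eventually_lt_const (by rw [hE0]; norm_num)).and
      ((hE'c.continuousAt.eventually_lt_const (by rw [hE'0]; exact hε)).and
        (gt_mem_nhds hξ₀))
  obtain ⟨r, hr, hball⟩ := Metric.eventually_nhds_iff.1 hev
  have hsmall : ∀ y ∈ Icc 0 (r / 2), E y < 1 / 2 ∧ E' y < ε ∧ y < ξ₀ := fun y hy =>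
    hball (by rw [Real.dist_0_eq_abs, abs_of_nonneg hy.1]; linarith [hy.2])
  refine ⟨r / 2, by linarith, (hsmall (r / 2) ⟨by linarith, le_rfl⟩).2.2.le, ?_⟩
  intro y hy t ht A hA B hB
  obtain ⟨hs1, hs2, hs3⟩ := hsmall y hy
  have hty := mul_mem_Icc_of_mem ht hy
  have ht1 : t ^ (1 / (m - 1)) ≤ 1 := Real.rpow_le_one ht.1 ht.2 hq
  have ht2 : t ^ (p * (1 / (m - 1))) ≤ 1 := Real.rpow_le_one ht.1 ht.2 hpq
  have ht10 : 0 ≤ t ^ (1 / (m - 1)) := Real.rpow_nonneg ht.1 _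
  have ht20 : 0 ≤ t ^ (p * (1 / (m - 1))) := Real.rpow_nonneg ht.1 _
  have hyg : 0 ≤ y ^ reactionExp m p := Real.rpow_nonneg hy.1 _
  have htyy : t * y ≤ y := mul_le_of_le_one_left hy.1 ht.2
  have hx0 : 0 ≤ ξ₀ - t * y := by linarith
  have hx1 : (ξ₀ - t * y) ^ σ ≤ ξ₀ ^ σ :=
    Real.rpow_le_rpow hx0 (by linarith [hty.1]) hσ.le
  have hx2 : 0 ≤ (ξ₀ - t * y) ^ σ := Real.rpow_nonneg hx0 _
  have hcoef1 : |(alpha m p σ + beta m p σ) * (y * t ^ (1 / (m - 1)))| ≤ a * y := by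
    rw [abs_mul, abs_of_nonneg (mul_nonneg hy.1 ht10)]
    exact mul_le_mul_of_nonneg_left (mul_le_of_le_one_right hy.1 ht1) ha0
  have hcoef2 : |c * (y ^ reactionExp m p * t ^ (p * (1 / (m - 1))) * (ξ₀ - t * y) ^ σ)|
      ≤ c * (y ^ reactionExp m p * ξ₀ ^ σ) := by
    rw [abs_of_nonneg (by positivity)]
    refine mul_le_mul_of_nonneg_left ?_ hc0
    exact mul_le_mul (mul_le_of_le_one_right hyg ht2) hx1 hx2 hyg
  have hcoef1' : 0 ≤ a * y := mul_nonneg ha0 hy.1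
  have hcoef2' : 0 ≤ c * (y ^ reactionExp m p * ξ₀ ^ σ) := by positivity
  constructor
  · have h1 := mul_le_mul hcoef1 (hb₁ A hA B hB) (abs_nonneg _) hcoef1'
    have h2 := mul_le_mul hcoef2 (hb₂ A hA B hB) (abs_nonneg _) hcoef2'
    rw [← abs_mul] at h1 h2
    have h0 : |-(beta m p σ * y)| ≤ |beta m p σ| * y := by
      rw [abs_neg, abs_mul, abs_of_nonneg hy.1]
    have hE' : E' y = |beta m p σ| * y + (a * y * K₁
      + c * (y ^ reactionExp m p * ξ₀ ^ σ) * K₂) := rfl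
    rw [kernel, ← hc, abs_le]
    rw [abs_le] at h0 h1 h2
    constructor <;> linarith
  · intro A' hA' B' hB' D hAD hBD
    have hD : 0 ≤ D := (abs_nonneg _).trans hAD
    have h1 := mul_le_mul hcoef1 (hl₁ A hA A' hA' B hB B' hB' D hAD hBD) (abs_nonneg _) hcoef1'
    have h2 := mul_le_mul hcoef2 (hl₂ A hA A' hA' B hB B' hB' D hAD hBD) (abs_nonneg _) hcoef2'
    rw [← abs_mul, mul_sub] at h1 h2
    have h3 : E y * D ≤ 1 / 2 * D := mul_le_mul_of_nonneg_right hs1.le hD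
    have h4 : E y * D = a * y * (K₁ * D) + c * (y ^ reactionExp m p * ξ₀ ^ σ) * (K₂ * D) := by
      simp only [E]
      ring
    rw [kernel, kernel, ← hc, abs_le]
    rw [abs_le] at h1 h2
    constructor <;> linarith

end Kernel

/-! ### Profiles: propagation of zeros and uniqueness where they are positive -/

/-- The combination `(f^m)' + β ξ f`, whose derivative, where `f` is positive, is
`(α + β) f - ξ^σ f^p` and does not involve derivatives of `f`. -/
def massFlux (m p σ : ℝ) (f : ℝ → ℝ) (ξ : ℝ) : ℝ :=
  deriv (fun s => f s ^ m) ξ + beta m p σ * ξ * f ξ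

section Profile

variable {m p σ a b c d ξ ξ₀ : ℝ} {f g : ℝ → ℝ}

theorem IsProfile.mono (h : IsProfile m p σ a f) (hab : a ≤ b) : IsProfile m p σ b f where
  nonneg ξ hξ := h.nonneg ξ (hab.trans_lt hξ)
  continuousOn := h.continuousOn.mono (Ioi_subset_Ioi hab)
  contDiffOn_pow := h.contDiffOn_pow.mono (Ioi_subset_Ioi hab)
  differentiableAt ξ hξ := h.differentiableAt ξ (hab.trans_lt hξ)
  differentiableAt_flux ξ hξ := h.differentiableAt_flux ξ (hab.trans_lt hξ)
  equation ξ hξ := h.equation ξ (hab.trans_lt hξ)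

theorem IsProfile.hasDerivAt_pow (h : IsProfile m p σ a f) (hξ : a < ξ) :
    HasDerivAt (fun s => f s ^ m) (deriv (fun s => f s ^ m) ξ) ξ :=
  ((h.contDiffOn_pow.differentiableOn one_ne_zero).differentiableAt (Ioi_mem_nhds hξ)).hasDerivAt

theorem IsProfile.continuousOn_massFlux (h : IsProfile m p σ a f) :
    ContinuousOn (massFlux m p σ f) (Ioi a) :=
  (h.contDiffOn_pow.continuousOn_deriv_of_isOpen isOpen_Ioi le_rfl).add
    ((continuousOn_const.mul continuousOn_id).mul h.continuousOn)

theorem IsProfile.hasDerivAt_massFlux (h : IsProfile m p σ a f) (hξ : a < ξ) (hpos : 0 < f ξ) :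
    HasDerivAt (massFlux m p σ f)
      ((alpha m p σ + beta m p σ) * f ξ - ξ ^ σ * f ξ ^ p) ξ := by
  have h1 := (h.differentiableAt_flux ξ hξ hpos).hasDerivAt
  have h2 := ((hasDerivAt_id ξ).const_mul (beta m p σ)).mul
    (h.differentiableAt ξ hξ hpos).hasDerivAt
  refine (h1.add h2).congr_deriv ?_
  have h3 := h.equation ξ hξ hpos
  simp only [id]
  linarith

theorem IsProfile.massFlux_eq_zero (hm : 1 < m) (h : IsProfile m p σ a f) (hξ : a < ξ)
    (h0 : f ξ = 0) : massFlux m p σ f ξ = 0 := by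
  have hmin : IsLocalMin (fun s => f s ^ m) ξ := by
    filter_upwards [Ioi_mem_nhds hξ] with s hs
    rw [h0, Real.zero_rpow (by linarith)]
    exact Real.rpow_nonneg (h.nonneg s hs) m
  rw [massFlux, hmin.deriv_eq_zero, h0]
  ring

/-- Once a profile has reached zero it stays zero: to the right of a last zero `e`, the reaction
term `ξ^σ f^p` dominates `(α + β) f`, hence `(f^m)' + β ξ f` becomes negative and `f^m` would
decrease below zero. -/
theorem IsProfile.eq_zero_of_le (hm : 1 < m) (hp : 0 < p) (hp1 : p < 1) (hσ : 0 < σ)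
    (hβ : 0 < beta m p σ) (h : IsProfile m p σ a f) (ha : 0 ≤ a) (hc : a < c) (hfc : f c = 0)
    (hcd : c ≤ d) : f d = 0 := by
  by_contra hfd
  have hcont : ContinuousOn f (Icc c d) := h.continuousOn.mono fun x hx => hc.trans_le hx.1
  obtain ⟨e, ⟨⟨hce, hed⟩, hfe⟩, hgreat⟩ :
      ∃ e, IsGreatest (Icc c d ∩ f ⁻¹' {0}) e :=
    (isCompact_Icc.of_isClosed_subset (hcont.preimage_isClosed_of_isClosed isClosed_Icc
      isClosed_singleton) inter_subset_left).exists_isGreatest ⟨c, ⟨le_rfl, hcd⟩, hfc⟩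
  have hfe : f e = 0 := hfe
  have hae : a < e := hc.trans_le hce
  have he0 : 0 < e := ha.trans_lt hae
  have hlt : e < d := lt_of_le_of_ne hed fun hh => hfd (hh ▸ hfe)
  have hpos : ∀ x ∈ Ioc e d, 0 < f x := fun x hx =>
    lt_of_le_of_ne (h.nonneg x (hae.trans hx.1)) fun h0 =>
      absurd (hgreat ⟨⟨hce.trans hx.1.le, hx.2⟩, h0.symm⟩) (not_le.2 hx.1)
  have hfat : ContinuousAt f e := h.continuousOn.continuousAt (Ioi_mem_nhds hae)
  have hev : ∀ᶠ x in 𝓝 e, (alpha m p σ + beta m p σ) * f x ^ (1 - p) - x ^ σ < 0 := by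
    have hc : ContinuousAt (fun x => (alpha m p σ + beta m p σ) * f x ^ (1 - p) - x ^ σ) e :=
      (continuousAt_const.mul (hfat.rpow_const (Or.inr (by linarith)))).sub
        (continuousAt_id.rpow_const (Or.inr hσ.le))
    refine hc.eventually_lt_const ?_
    simp only [hfe, Real.zero_rpow (by linarith : (1 - p) ≠ 0), mul_zero, zero_sub]
    exact neg_lt_zero.2 (Real.rpow_pos_of_pos he0 σ)
  obtain ⟨r, hr, hball⟩ := Metric.eventually_nhds_iff.1 hev
  obtain ⟨k, hek, hk⟩ : ∃ k, e < k ∧ k < min d (e + r) :=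
    exists_between (lt_min hlt (by linarith))
  have hkd : k < d := hk.trans_le (min_le_left _ _)
  have hkr : k < e + r := hk.trans_le (min_le_right _ _)
  have hZ : StrictAntiOn (massFlux m p σ f) (Icc e k) := by
    refine strictAntiOn_of_deriv_neg (convex_Icc _ _)
      (h.continuousOn_massFlux.mono fun x hx => hae.trans_le hx.1) fun x hx => ?_
    rw [interior_Icc] at hx
    have hfx := hpos x ⟨hx.1, (hx.2.trans hkd).le⟩
    rw [(h.hasDerivAt_massFlux (hae.trans hx.1) hfx).deriv]
    have h1 := hball (y := x) (by
      rw [Real.dist_eq, abs_of_pos (by linarith [hx.1])]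
      linarith [hx.2])
    have h2 : f x = f x ^ p * f x ^ (1 - p) := by
      rw [← Real.rpow_add hfx, add_sub_cancel, Real.rpow_one]
    have h3 := mul_neg_of_pos_of_neg (Real.rpow_pos_of_pos hfx p) h1
    calc _ = f x ^ p * ((alpha m p σ + beta m p σ) * f x ^ (1 - p) - x ^ σ) := by
          nth_rw 1 [h2]
          ring
      _ < 0 := h3
  have hF : StrictAntiOn (fun s => f s ^ m) (Icc e k) := by
    refine strictAntiOn_of_deriv_neg (convex_Icc _ _)
      (h.contDiffOn_pow.continuousOn.mono fun x hx => hae.trans_le hx.1) fun x hx => ?_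
    rw [interior_Icc] at hx
    have h1 := hZ ⟨le_rfl, hek.le⟩ ⟨hx.1.le, hx.2.le⟩ hx.1
    rw [h.massFlux_eq_zero hm hae hfe, massFlux] at h1
    have h2 : 0 ≤ beta m p σ * x * f x :=
      mul_nonneg (mul_nonneg hβ.le (he0.trans hx.1).le) (h.nonneg x (hae.trans hx.1))
    linarith
  have h1 := hF ⟨le_rfl, hek.le⟩ ⟨hek.le, le_rfl⟩ hek
  simp only [hfe, Real.zero_rpow (by linarith : m ≠ 0)] at h1
  exact absurd (Real.rpow_nonneg (h.nonneg k (hae.trans hek)) m) (not_le.2 h1)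

/-- A profile is positive everywhere to the left of an interface. -/
theorem IsProfile.pos_of_lt_interface (hm : 1 < m) (hp : 0 < p) (hp1 : p < 1) (hσ : 0 < σ)
    (hβ : 0 < beta m p σ) (h : IsProfile m p σ a f) (ha : 0 ≤ a) (hI : HasInterface m f ξ₀)
    (hξ : ξ ∈ Ioo a ξ₀) : 0 < f ξ := by
  refine lt_of_le_of_ne (h.nonneg ξ hξ.1) fun h0 => ?_
  obtain ⟨δ, hδ, hpos⟩ := hI.pos_left
  obtain ⟨k, hk, hk'⟩ := exists_between (max_lt (by linarith : ξ₀ - δ < ξ₀) hξ.2)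
  have h1 := hpos k ⟨(le_max_left _ _).trans_lt hk, hk'⟩
  exact h1.ne' (h.eq_zero_of_le hm hp hp1 hσ hβ ha hξ.1 h0.symm
    ((le_max_right _ _).trans hk.le))

/-- The profile equation as a first order system for `(f^m, (f^m)' + β ξ f)`. -/
def phaseField (m p σ ξ : ℝ) (z : ℝ × ℝ) : ℝ × ℝ :=
  (z.2 - beta m p σ * ξ * z.1 ^ (1 / m),
    (alpha m p σ + beta m p σ) * z.1 ^ (1 / m) - ξ ^ σ * z.1 ^ (p / m))

theorem contDiffOn_phaseField :
    ContDiffOn ℝ 1 (fun z : ℝ × ℝ × ℝ => phaseField m p σ z.1 z.2) {z | 0 < z.1 ∧ 0 < z.2.1} := by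
  have h1 (r : ℝ) : ContDiffOn ℝ 1 (fun z : ℝ × ℝ × ℝ => z.2.1 ^ r) {z | 0 < z.1 ∧ 0 < z.2.1} :=
    (by fun_prop : ContDiff ℝ 1 fun z : ℝ × ℝ × ℝ => z.2.1).contDiffOn.rpow_const_of_ne
      fun z hz => hz.2.ne'
  have h2 : ContDiffOn ℝ 1 (fun z : ℝ × ℝ × ℝ => z.1 ^ σ) {z | 0 < z.1 ∧ 0 < z.2.1} :=
    contDiff_fst.contDiffOn.rpow_const_of_ne fun z hz => hz.1.ne'
  have h3 : ContDiffOn ℝ 1 (fun z : ℝ × ℝ × ℝ => z.2.2) {z | 0 < z.1 ∧ 0 < z.2.1} :=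
    (by fun_prop : ContDiff ℝ 1 fun z : ℝ × ℝ × ℝ => z.2.2).contDiffOn
  exact (h3.sub ((contDiffOn_const.mul contDiff_fst.contDiffOn).mul (h1 _))).prodMk
    ((contDiffOn_const.mul (h1 _)).sub (h2.mul (h1 _)))

theorem IsProfile.hasDerivAt_phase (hm : 1 < m) (h : IsProfile m p σ a f) (hξ : a < ξ)
    (hpos : 0 < f ξ) :
    HasDerivAt (fun s => (f s ^ m, massFlux m p σ f s))
      (phaseField m p σ ξ (f ξ ^ m, massFlux m p σ f ξ)) ξ := by
  refine ((h.hasDerivAt_pow hξ).prodMk (h.hasDerivAt_massFlux hξ hpos)).congr_deriv ?_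
  have hm0 : m ≠ 0 := by linarith
  simp only [phaseField, ← Real.rpow_mul hpos.le, mul_one_div_cancel hm0, Real.rpow_one,
    mul_div_cancel₀ p hm0, massFlux]
  ring_nf

/-- Backward uniqueness, for the regular equation, on an interval where both profiles are
positive. -/
theorem IsProfile.eqOn_Icc (hm : 1 < m) (hf : IsProfile m p σ a f) (hg : IsProfile m p σ a g)
    (ha : 0 ≤ a) (hac : a < c) (hcd : c ≤ d) (hfpos : ∀ x ∈ Icc c d, 0 < f x)
    (hgpos : ∀ x ∈ Icc c d, 0 < g x) (hd : f =ᶠ[𝓝 d] g) : EqOn f g (Icc c d) := by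
  have hm0 : m ≠ 0 := by linarith
  have hsub : Icc c d ⊆ Ioi a := fun x hx => hac.trans_le hx.1
  -- a compact convex box, away from zero in its second factor, that contains both trajectories
  have hbox : ∀ u : ℝ → ℝ, IsProfile m p σ a u → (∀ x ∈ Icc c d, 0 < u x) →
      ∃ lo > 0, ∃ M : ℝ, ∀ x ∈ Icc c d,
        (u x ^ m, massFlux m p σ u x) ∈ Icc lo M ×ˢ Icc (-M) M := by
    intro u hu hupos
    have h1 : ContinuousOn (fun s => u s ^ m) (Icc c d) := hu.contDiffOn_pow.continuousOn.mono hsub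
    obtain ⟨x₀, hx₀, hmin⟩ := isCompact_Icc.exists_isMinOn (nonempty_Icc.2 hcd) h1
    obtain ⟨M₁, hM₁⟩ := isCompact_Icc.exists_bound_of_continuousOn h1
    obtain ⟨M₂, hM₂⟩ := isCompact_Icc.exists_bound_of_continuousOn
      (hu.continuousOn_massFlux.mono hsub)
    refine ⟨u x₀ ^ m, Real.rpow_pos_of_pos (hupos _ hx₀) m, max M₁ M₂, fun x hx =>
      ⟨⟨hmin hx, ?_⟩, abs_le.1 ((hM₂ x hx).trans (le_max_right _ _))⟩⟩
    exact (le_abs_self _).trans ((hM₁ x hx).trans (le_max_left _ _))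
  obtain ⟨lo₁, hlo₁, M₁, hM₁⟩ := hbox f hf hfpos
  obtain ⟨lo₂, hlo₂, M₂, hM₂⟩ := hbox g hg hgpos
  let s : Set (ℝ × ℝ) :=
    Icc (min lo₁ lo₂) (max M₁ M₂) ×ˢ Icc (-(max M₁ M₂)) (max M₁ M₂)
  have hs₁ : ∀ x ∈ Icc c d, (f x ^ m, massFlux m p σ f x) ∈ s := fun x hx =>
    prod_mono (Icc_subset_Icc (min_le_left _ _) (le_max_left _ _))
      (Icc_subset_Icc (neg_le_neg (le_max_left _ _)) (le_max_left _ _)) (hM₁ x hx)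
  have hs₂ : ∀ x ∈ Icc c d, (g x ^ m, massFlux m p σ g x) ∈ s := fun x hx =>
    prod_mono (Icc_subset_Icc (min_le_right _ _) (le_max_right _ _))
      (Icc_subset_Icc (neg_le_neg (le_max_right _ _)) (le_max_right _ _)) (hM₂ x hx)
  obtain ⟨K, hK⟩ := ((contDiffOn_phaseField (m := m) (p := p) (σ := σ)).mono
    (s := {z | 0 < z.1 ∧ 0 < z.2.1}) (t := Icc c d ×ˢ s) fun z hz =>
      ⟨(ha.trans_lt hac).trans_le hz.1.1, (lt_min hlo₁ hlo₂).trans_le hz.2.1.1⟩)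
    |>.exists_lipschitzOnWith one_ne_zero
      ((convex_Icc _ _).prod ((convex_Icc _ _).prod (convex_Icc _ _)))
      (isCompact_Icc.prod (isCompact_Icc.prod isCompact_Icc))
  have hLip : ∀ t ∈ Ioc c d, LipschitzOnWith K (phaseField m p σ t) s := fun t ht =>
    LipschitzOnWith.of_dist_le_mul fun x hx y hy => by
      have := hK.dist_le_mul (t, x) ⟨⟨ht.1.le, ht.2⟩, hx⟩ (t, y) ⟨⟨ht.1.le, ht.2⟩, hy⟩
      rwa [Prod.dist_eq (x := (t, x)), dist_self, max_eq_right dist_nonneg] at this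
  have hcont : ∀ u : ℝ → ℝ, IsProfile m p σ a u →
      ContinuousOn (fun s => (u s ^ m, massFlux m p σ u s)) (Icc c d) := fun u hu =>
    (hu.contDiffOn_pow.continuousOn.mono hsub).prodMk (hu.continuousOn_massFlux.mono hsub)
  have hend : (f d ^ m, massFlux m p σ f d) = (g d ^ m, massFlux m p σ g d) := by
    have h1 : (fun s => f s ^ m) =ᶠ[𝓝 d] fun s => g s ^ m := hd.mono fun x hx => by
      simp only [hx]
    rw [massFlux, massFlux, h1.deriv_eq, hd.eq_of_nhds]
  have key := ODE_solution_unique_of_mem_Icc_left (s := fun _ => s) hLip (hcont f hf)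
    (fun t ht => (hf.hasDerivAt_phase hm (hac.trans ht.1)
      (hfpos t ⟨ht.1.le, ht.2⟩)).hasDerivWithinAt) (fun t ht => hs₁ t ⟨ht.1.le, ht.2⟩)
    (hcont g hg) (fun t ht => (hg.hasDerivAt_phase hm (hac.trans ht.1)
      (hgpos t ⟨ht.1.le, ht.2⟩)).hasDerivWithinAt) (fun t ht => hs₂ t ⟨ht.1.le, ht.2⟩) hend
  intro x hx
  have hx' : f x ^ m = g x ^ m := congrArg Prod.fst (key hx)
  exact (Real.rpow_left_inj (hfpos x hx).le (hgpos x hx).le hm0).1 hx'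

end Profile

/-! ### The rescaled pressure of a profile with a Type I interface -/

section Pressure

variable {m p σ b ξ₀ lo hi δ : ℝ} {g w : ℝ → ℝ}

theorem slope_truncKernel (hw : ∀ x ∈ Icc 0 δ, w x ∈ Icc lo hi) {y : ℝ} (hy : y ∈ Icc 0 δ) :
    slope (truncKernel m p σ ξ₀ lo hi) w y = slope (kernel m p σ ξ₀) w y := by
  refine intervalIntegral.integral_congr fun t ht => ?_
  rw [uIcc_of_le zero_le_one] at ht
  simp only [truncKernel, truncate_of_mem (hw y hy),
    truncate_of_mem (hw _ (mul_mem_Icc_of_mem ht hy))]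

theorem ofPressure_pressure (hm : 1 < m) {x A : ℝ} (hx : 0 < x) (hA : 0 ≤ A) :
    ofPressure m x (m / (m - 1) * A ^ (m - 1) / x) = A := by
  have h1 : m - 1 ≠ 0 := by linarith
  have h2 : m ≠ 0 := by linarith
  have : (m - 1) / m * x * (m / (m - 1) * A ^ (m - 1) / x) = A ^ (m - 1) := by
    field_simp
  rw [ofPressure, this, ← Real.rpow_mul hA, mul_one_div_cancel h1, Real.rpow_one]

theorem tendsto_pressure_div (hm : 1 < m) (h : IsProfile m p σ b g) (hb : b < ξ₀)
    (hI : HasTypeIInterface m g ξ₀) :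
    ∃ W > 0, Tendsto (fun x => m / (m - 1) * g (ξ₀ - x) ^ (m - 1) / x) (𝓝[>] 0) (𝓝 W) := by
  obtain ⟨C, hC, hequiv⟩ := hI.behavior
  have h1 : 0 < m - 1 := by linarith
  have hsub : Tendsto (fun x : ℝ => ξ₀ - x) (𝓝[>] 0) (𝓝[<] ξ₀) := by
    refine tendsto_nhdsWithin_iff.2 ⟨?_, ?_⟩
    · have : Tendsto (fun x : ℝ => ξ₀ - x) (𝓝 0) (𝓝 (ξ₀ - 0)) :=
        (continuous_const.sub continuous_id).tendsto 0
      rw [sub_zero] at this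
      exact this.mono_left nhdsWithin_le_nhds
    · filter_upwards [self_mem_nhdsWithin] with x hx
      have : (0 : ℝ) < x := hx
      simpa using this
  have hne : ∀ᶠ ξ in 𝓝[<] ξ₀, C * (ξ₀ - ξ) ^ (1 / (m - 1)) ≠ 0 := by
    filter_upwards [self_mem_nhdsWithin] with ξ hξ
    exact (mul_pos hC (Real.rpow_pos_of_pos (sub_pos.2 hξ) _)).ne'
  have hone := ((Asymptotics.isEquivalent_iff_tendsto_one hne).1 hequiv).comp hsub
  have hpow := (hone.rpow_const (p := m - 1) (Or.inl one_ne_zero)).const_mul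
    (m / (m - 1) * C ^ (m - 1))
  rw [Real.one_rpow, mul_one] at hpow
  refine ⟨m / (m - 1) * C ^ (m - 1), mul_pos (div_pos (by linarith) h1)
    (Real.rpow_pos_of_pos hC _), hpow.congr' ?_⟩
  filter_upwards [Ioo_mem_nhdsGT (sub_pos.2 hb)] with x hx
  have hx0 : 0 < x := hx.1
  have hg : 0 ≤ g (ξ₀ - x) := h.nonneg _ (by
    have := hx.2
    rw [mem_Ioi]
    linarith)
  simp only [Function.comp, Pi.div_apply, sub_sub_cancel]
  rw [Real.div_rpow hg (by positivity), Real.mul_rpow hC.le (by positivity),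
    ← Real.rpow_mul hx0.le, one_div_mul_cancel h1.ne', Real.rpow_one]
  have := (Real.rpow_pos_of_pos hC (m - 1)).ne'
  field_simp

/-- A profile with a Type I interface at `ξ₀` is `ofPressure m x (w x)` at `ξ₀ - x`, where the
rescaled pressure `w` is continuous and positive up to the interface and solves the fixed-point
equation of the truncated kernel, whatever the truncation levels containing its values. -/
theorem IsProfile.exists_rescaledPressure (hm : 1 < m) (hp : 0 < p) (hp1 : p < 1)
    (hmp : 2 < m + p) (hσ : 0 < σ) (hβ : 0 < beta m p σ) (h : IsProfile m p σ b g) (hb : 0 ≤ b)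
    (hI : HasTypeIInterface m g ξ₀) (hδ : 0 < δ) (hδb : δ < ξ₀ - b) :
    ∃ w : ℝ → ℝ, Continuous w ∧ (∀ x ∈ Icc 0 δ, 0 < w x) ∧
      (∀ x ∈ Icc 0 δ, g (ξ₀ - x) = ofPressure m x (w x)) ∧
      ∀ lo hi, 0 < lo → (∀ x ∈ Icc 0 δ, w x ∈ Icc lo hi) →
        ∀ x ∈ Icc 0 δ, w x = meanSlope (truncKernel m p σ ξ₀ lo hi) w x := by
  have h1 : 0 < m - 1 := by linarith
  have hdom : ∀ x ∈ Icc 0 δ, ξ₀ - x ∈ Ioi b := fun x hx => by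
    rw [mem_Ioi]
    linarith [hx.2]
  have hpos : ∀ x ∈ Ioc 0 δ, 0 < g (ξ₀ - x) := fun x hx =>
    h.pos_of_lt_interface hm hp hp1 hσ hβ hb hI.hasInterface
      ⟨hdom x ⟨hx.1.le, hx.2⟩, by linarith [hx.1]⟩
  obtain ⟨W, hW, hlim⟩ := tendsto_pressure_div hm h (by linarith : b < ξ₀) hI
  have hgc : ContinuousOn (fun x => g (ξ₀ - x)) (Icc 0 δ) :=
    h.continuousOn.comp (by fun_prop) hdom
  let w₀ : ℝ → ℝ := Function.update (fun x => m / (m - 1) * g (ξ₀ - x) ^ (m - 1) / x) 0 W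
  have hw₀ : ContinuousOn w₀ (Icc 0 δ) := by
    intro x hx
    rcases eq_or_lt_of_le hx.1 with rfl | hx0
    · refine continuousWithinAt_update_same.2 (hlim.mono_left (nhdsWithin_mono _ ?_))
      rintro y ⟨hy, hy0⟩
      exact lt_of_le_of_ne hy.1 (Ne.symm hy0)
    · refine (continuousWithinAt_update_of_ne hx0.ne').2 ?_
      exact (continuousWithinAt_const.mul ((hgc x hx).rpow_const (Or.inr h1.le))).div
        continuousWithinAt_id hx0.ne'
  let w : ℝ → ℝ := IccExtend hδ.le ((Icc 0 δ).domRestrict w₀)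
  have hwc : Continuous w := hw₀.domRestrict.Icc_extend'
  have hwv : ∀ x ∈ Ioc 0 δ, w x = m / (m - 1) * g (ξ₀ - x) ^ (m - 1) / x := fun x hx => by
    simp only [w, IccExtend_of_mem hδ.le _ (⟨hx.1.le, hx.2⟩ : x ∈ Icc 0 δ), domRestrict_apply, w₀,
      Function.update_of_ne hx.1.ne']
  have hw0 : w 0 = W := by
    simp only [w, IccExtend_of_mem hδ.le _ (⟨le_rfl, hδ.le⟩ : (0 : ℝ) ∈ Icc 0 δ), domRestrict_apply,
      w₀, Function.update_self]
  have hwpos : ∀ x ∈ Icc 0 δ, 0 < w x := fun x hx => by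
    rcases eq_or_lt_of_le hx.1 with rfl | hx0
    · rwa [hw0]
    · rw [hwv x ⟨hx0, hx.2⟩]
      exact div_pos (mul_pos (div_pos (by linarith) h1)
        (Real.rpow_pos_of_pos (hpos x ⟨hx0, hx.2⟩) _)) hx0
  have hgw : ∀ x ∈ Icc 0 δ, g (ξ₀ - x) = ofPressure m x (w x) := fun x hx => by
    rcases eq_or_lt_of_le hx.1 with rfl | hx0
    · rw [sub_zero, hI.hasInterface.eq_zero, ofPressure, mul_zero, zero_mul,
        Real.zero_rpow (one_div_pos.2 h1).ne']
    · rw [hwv x ⟨hx0, hx.2⟩, ofPressure_pressure hm hx0 (hpos x ⟨hx0, hx.2⟩).le]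
  -- the integrated equation, in terms of the distance to the interface
  have hflux : ∀ x ∈ Icc 0 δ, ∫ y in (0 : ℝ)..x, ((alpha m p σ + beta m p σ) * g (ξ₀ - y)
      - (ξ₀ - y) ^ σ * g (ξ₀ - y) ^ p) = -massFlux m p σ g (ξ₀ - x) := by
    intro x hx
    have hsub : Icc 0 x ⊆ Icc 0 δ := Icc_subset_Icc_right hx.2
    have hcont : ContinuousOn (fun y => -massFlux m p σ g (ξ₀ - y)) (Icc 0 x) :=
      (h.continuousOn_massFlux.comp (by fun_prop) fun y hy => hdom y (hsub hy)).neg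
    have hint : IntervalIntegrable (fun y => (alpha m p σ + beta m p σ) * g (ξ₀ - y)
        - (ξ₀ - y) ^ σ * g (ξ₀ - y) ^ p) MeasureTheory.volume 0 x := by
      refine ContinuousOn.intervalIntegrable ?_
      rw [uIcc_of_le hx.1]
      exact (continuousOn_const.mul (hgc.mono hsub)).sub
        (((continuousOn_const.sub continuousOn_id).rpow_const fun _ _ => Or.inr hσ.le).mul
          ((hgc.mono hsub).rpow_const fun _ _ => Or.inr hp.le))
    rw [intervalIntegral.integral_eq_sub_of_hasDerivAt_of_le hx.1 hcont (fun y hy => ?_) hint]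
    · simp only [sub_zero]
      rw [h.massFlux_eq_zero hm (by linarith : b < ξ₀) hI.hasInterface.eq_zero]
      ring
    · have hyδ : y ∈ Ioc 0 δ := ⟨hy.1, hy.2.le.trans hx.2⟩
      have hd := (h.hasDerivAt_massFlux (hdom y ⟨hyδ.1.le, hyδ.2⟩) (hpos y hyδ)).comp_const_sub
        ξ₀ y
      refine hd.neg.congr_deriv ?_
      simp
  have hderiv : ∀ x ∈ Ioo 0 δ,
      HasDerivAt (fun y => y * w y) (slope (kernel m p σ ξ₀) w x) x := by
    intro x hx
    have hxδ : x ∈ Icc 0 δ := ⟨hx.1.le, hx.2.le⟩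
    have hgx := hpos x ⟨hx.1, hx.2.le⟩
    have hd := (h.differentiableAt _ (hdom x hxδ) hgx).hasDerivAt
    have hpowm : deriv (fun s => g s ^ m) (ξ₀ - x)
        = deriv g (ξ₀ - x) * m * g (ξ₀ - x) ^ (m - 1) :=
      (hd.rpow_const (Or.inl hgx.ne')).deriv
    have hslope := ofPressure_mul_slope (ξ₀ := ξ₀) hm hp hσ hwc hwpos
      (⟨hx.1, hx.2.le⟩ : x ∈ Ioc 0 δ)
    rw [intervalIntegral.integral_congr (g := fun y => (alpha m p σ + beta m p σ) * g (ξ₀ - y)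
      - (ξ₀ - y) ^ σ * g (ξ₀ - y) ^ p) (fun y hy => by
        rw [uIcc_of_le hx.1.le] at hy
        simp only [hgw y ⟨hy.1, hy.2.trans hx.2.le⟩]), hflux x hxδ, ← hgw x hxδ, massFlux,
      hpowm] at hslope
    have hpow : g (ξ₀ - x) ^ (m - 1) = g (ξ₀ - x) ^ (m - 1 - 1) * g (ξ₀ - x) := by
      rw [← Real.rpow_add_one hgx.ne', sub_add_cancel]
    have hval : slope (kernel m p σ ξ₀) w x
        = m / (m - 1) * (-deriv g (ξ₀ - x) * (m - 1) * g (ξ₀ - x) ^ (m - 1 - 1)) := by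
      refine mul_left_cancel₀ hgx.ne' ?_
      rw [hslope, hpow]
      field_simp
      ring
    rw [hval]
    have hd' : HasDerivAt (fun y => g (ξ₀ - y)) (-deriv g (ξ₀ - x)) x :=
      hd.comp_const_sub ξ₀ x
    refine ((hd'.rpow_const (p := m - 1) (Or.inl hgx.ne')).const_mul
      (m / (m - 1))).congr_of_eventuallyEq ?_
    filter_upwards [Ioo_mem_nhds hx.1 hx.2] with y hy
    rw [hwv y ⟨hy.1, hy.2.le⟩, mul_div_cancel₀ _ hy.1.ne']
  refine ⟨w, hwc, hwpos, hgw, fun lo hi hlo hmem x hx => ?_⟩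
  have hHc := continuous_truncKernel (ξ₀ := ξ₀) hm hp hmp hσ hlo
    ((hmem 0 ⟨le_rfl, hδ.le⟩).1.trans (hmem 0 ⟨le_rfl, hδ.le⟩).2)
  have hpt : ∀ x ∈ Ioc 0 δ, w x = meanSlope (truncKernel m p σ ξ₀ lo hi) w x := by
    intro x hx
    refine mul_left_cancel₀ hx.1.ne' ?_
    rw [mul_meanSlope, intervalIntegral.integral_eq_sub_of_hasDerivAt_of_le
      (f := fun y => y * w y) hx.1.le (continuous_id.mul hwc).continuousOn (fun y hy => ?_)
      ((continuous_slope hHc hwc).intervalIntegrable _ _)]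
    · simp
    · have hy' : y ∈ Ioo 0 δ := ⟨hy.1, hy.2.trans_le hx.2⟩
      rw [slope_truncKernel hmem ⟨hy'.1.le, hy'.2.le⟩]
      exact hderiv y hy'
  have hclosed : IsClosed {x | w x = meanSlope (truncKernel m p σ ξ₀ lo hi) w x} :=
    isClosed_eq hwc (continuous_meanSlope hHc hwc)
  -- the equation holds for positive `x` and extends to `x = 0` by continuity
  have hclosure : closure (Ioc 0 δ) ⊆ {x | w x = meanSlope (truncKernel m p σ ξ₀ lo hi) w x} :=
    closure_minimal hpt hclosed
  rw [closure_Ioc hδ.ne] at hclosure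
  exact hclosure hx

end Pressure

/-! ### Local existence -/

section Existence

variable {m p σ ξ₀ : ℝ}

/-- The fixed-point equation has a solution near the interface. The truncation is inactive on it,
because the kernel is close to `β ξ₀`. -/
theorem exists_rescaledPressure (hm : 1 < m) (hp : 0 < p) (hmp : 2 < m + p) (hσ : 0 < σ)
    (hβ : 0 < beta m p σ) (hξ₀ : 0 < ξ₀) :
    ∃ δ > 0, δ ≤ ξ₀ ∧ ∃ w : ℝ → ℝ, Continuous w ∧ (∀ x ∈ Icc 0 δ, 0 < w x) ∧
      ∀ x ∈ Ioo 0 δ, HasDerivAt (fun y => y * w y) (slope (kernel m p σ ξ₀) w x) x := by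
  have hc : 0 < beta m p σ * ξ₀ := mul_pos hβ hξ₀
  set ε := beta m p σ * ξ₀ / 2 with hε
  have hε0 : 0 < ε := by positivity
  have hle : ε ≤ 3 * ε := by linarith
  obtain ⟨δ, hδ, hδξ, hest⟩ := exists_kernel_estimates (hi := 3 * ε) hm hp hmp hσ hξ₀ hε0 hε0
  have hHc := continuous_truncKernel (ξ₀ := ξ₀) hm hp hmp hσ hε0 hle
  obtain ⟨w, hwc, hw⟩ := exists_eq_meanSlope (δ := δ) hHc hδ.le
    fun y hy t ht A A' B B' D hAD hBD =>
      (hest y hy t ht _ (truncate_mem hle A) _ (truncate_mem hle B)).2 _ (truncate_mem hle A') _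
        (truncate_mem hle B') D ((abs_truncate_sub_le _ _ _ _).trans hAD)
        ((abs_truncate_sub_le _ _ _ _).trans hBD)
  have hmem : ∀ x ∈ Icc 0 δ, w x ∈ Icc ε (3 * ε) := by
    intro x hx
    have hconst : beta m p σ * ξ₀
        = ∫ _s in (0 : ℝ)..1, ∫ _t in (0 : ℝ)..1, beta m p σ * ξ₀ := by simp
    have h1 : |w x - beta m p σ * ξ₀| ≤ ε := by
      rw [hw x hx, hconst]
      refine abs_integral_sub_le ((continuous_slope hHc hwc).comp (continuous_mul_const x))
        continuous_const fun s hs => ?_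
      have hsx := mul_mem_Icc_of_mem hs hx
      exact abs_integral_sub_le
        ((continuous_slope_integrand hHc hwc).comp (Continuous.prodMk_right (s * x)))
        continuous_const fun t ht =>
          (hest _ hsx t ht _ (truncate_mem hle _) _ (truncate_mem hle _)).1
    rw [abs_le] at h1
    constructor <;> linarith [h1.1, h1.2]
  refine ⟨δ, hδ, hδξ, w, hwc, fun x hx => hε0.trans_le (hmem x hx).1, fun x hx => ?_⟩
  have hs := continuous_slope hHc hwc
  rw [← slope_truncKernel hmem ⟨hx.1.le, hx.2.le⟩]
  refine (intervalIntegral.integral_hasDerivAt_right (hs.intervalIntegrable 0 x)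
    (hs.stronglyMeasurableAtFilter _ _) hs.continuousAt).congr_of_eventuallyEq ?_
  filter_upwards [Ioo_mem_nhds hx.1 hx.2] with y hy
  rw [← mul_meanSlope]
  exact congrArg (y * ·) (hw y ⟨hy.1.le, hy.2.le⟩)

/-- Some profile, defined close to `ξ₀` and to the right of it, has an interface of Type I
there. -/
theorem exists_isProfile (hm : 1 < m) (hp : 0 < p) (hmp : 2 < m + p) (hσ : 0 < σ)
    (hβ : 0 < beta m p σ) (hξ₀ : 0 < ξ₀) :
    ∃ (b : ℝ) (g : ℝ → ℝ), 0 ≤ b ∧ b < ξ₀ ∧ IsProfile m p σ b g ∧ HasTypeIInterface m g ξ₀ := by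
  obtain ⟨δ, hδ, hδξ, w, hwc, hwpos, hderiv⟩ := exists_rescaledPressure hm hp hmp hσ hβ hξ₀
  have hm1 : 0 < m - 1 := by linarith
  have hm0 : 0 < m := by linarith
  have hq : 0 < 1 / (m - 1) := one_div_pos.2 hm1
  have hk : 0 < (m - 1) / m := div_pos hm1 hm0
  -- the profile as a function of the distance to the interface, zero at negative distances
  let φ : ℝ → ℝ := fun x => ofPressure m (max x 0) (w x)
  have hφc : Continuous φ :=
    ((continuous_const.mul (continuous_id.max continuous_const)).mul hwc).rpow_const
      fun _ => Or.inr hq.le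
  have hφneg : ∀ x ≤ 0, φ x = 0 := fun x hx => by
    simp only [φ, ofPressure, max_eq_right hx, mul_zero, zero_mul, Real.zero_rpow hq.ne']
  have hφpos : ∀ x, 0 ≤ x → φ x = ofPressure m x (w x) := fun x hx => by
    simp only [φ, max_eq_left hx]
  have hφ0 : ∀ x ∈ Ioo 0 δ, 0 < φ x := fun x hx => by
    rw [hφpos x hx.1.le]
    exact ofPressure_pos hm hx.1 (hwpos x ⟨hx.1.le, hx.2.le⟩)
  let k : ℝ → ℝ := fun y => (alpha m p σ + beta m p σ) * φ y - (ξ₀ - y) ^ σ * φ y ^ p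
  have hkc : Continuous k := (continuous_const.mul hφc).sub
    (((continuous_const.sub continuous_id).rpow_const fun _ => Or.inr hσ.le).mul
      (hφc.rpow_const fun _ => Or.inr hp.le))
  let J : ℝ → ℝ := fun x => beta m p σ * (ξ₀ - x) * φ x + ∫ y in (0 : ℝ)..x, k y
  have hkd (x : ℝ) : HasDerivAt (fun x => ∫ y in (0 : ℝ)..x, k y) (k x) x :=
    intervalIntegral.integral_hasDerivAt_right (hkc.intervalIntegrable 0 x)
      (hkc.stronglyMeasurableAtFilter _ _) hkc.continuousAt
  have hJc : Continuous J :=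
    ((continuous_const.mul (continuous_const.sub continuous_id)).mul hφc).add
      (continuous_iff_continuousAt.2 fun x => (hkd x).continuousAt)
  have hJ0 : ∀ x ≤ 0, J x = 0 := fun x hx => by
    have : ∫ y in (0 : ℝ)..x, k y = ∫ y in (0 : ℝ)..x, (0 : ℝ) := by
      refine intervalIntegral.integral_congr fun y hy => ?_
      rw [uIcc_of_ge hx] at hy
      simp [k, hφneg y hy.2, Real.zero_rpow hp.ne']
    simp [J, hφneg x hx, this]
  have hφd : ∀ x ∈ Ioo 0 δ, DifferentiableAt ℝ φ x := fun x hx => by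
    have hb : 0 < (m - 1) / m * (x * w x) :=
      mul_pos hk (mul_pos hx.1 (hwpos x ⟨hx.1.le, hx.2.le⟩))
    refine (((hderiv x hx).const_mul ((m - 1) / m)).rpow_const (p := 1 / (m - 1))
      (Or.inl hb.ne')).differentiableAt.congr_of_eventuallyEq ?_
    filter_upwards [Ioi_mem_nhds hx.1] with y hy
    rw [hφpos y (le_of_lt hy), ofPressure, mul_assoc]
  have hpow : ∀ x < δ, HasDerivAt (fun y => φ y ^ m) (J x) x := by
    intro x hx
    rcases lt_trichotomy x 0 with hx0 | rfl | hx0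
    · rw [hJ0 x hx0.le]
      refine (hasDerivAt_const x (0 : ℝ)).congr_of_eventuallyEq ?_
      filter_upwards [Iio_mem_nhds hx0] with y hy
      rw [hφneg y (le_of_lt hy), Real.zero_rpow hm0.ne']
    · rw [hJ0 0 le_rfl, hasDerivAt_iff_isLittleO]
      -- `φ ^ m` is the product of `max y 0` and a function vanishing at `0`
      have h1 : Tendsto (fun y => φ y * ((m - 1) / m * w y)) (𝓝 0) (𝓝 0) := by
        have : Continuous fun y => φ y * ((m - 1) / m * w y) :=
          hφc.mul (continuous_const.mul hwc)
        simpa [hφneg 0 le_rfl] using this.tendsto 0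
      have h2 : (fun y : ℝ => max y 0) =O[𝓝 0] fun y => y := by
        refine Asymptotics.IsBigO.of_bound 1 (Eventually.of_forall fun y => ?_)
        rw [one_mul, Real.norm_eq_abs, Real.norm_eq_abs, abs_of_nonneg (le_max_right _ _)]
        exact max_le (le_abs_self y) (abs_nonneg y)
      have h3 := ((Asymptotics.isLittleO_one_iff ℝ).2 h1).mul_isBigO h2
      simp only [one_mul] at h3
      refine h3.congr' ?_ (by simp)
      filter_upwards [Iio_mem_nhds hx] with y hy
      rw [hφneg 0 le_rfl, Real.zero_rpow hm0.ne', smul_zero, sub_zero, sub_zero]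
      rcases le_or_gt y 0 with hy0 | hy0
      · rw [hφneg y hy0, Real.zero_rpow hm0.ne', zero_mul, zero_mul]
      · have hwy := hwpos y ⟨hy0.le, le_of_lt hy⟩
        have h4 : φ y ^ (m - 1) = (m - 1) / m * y * w y := by
          rw [hφpos y hy0.le, ofPressure, ← Real.rpow_mul (by positivity),
            one_div_mul_cancel hm1.ne', Real.rpow_one]
        have h5 : φ y ^ m = φ y ^ (m - 1) * φ y := by
          rw [← Real.rpow_add_one (hφ0 y ⟨hy0, hy⟩).ne', sub_add_cancel]
        rw [h5, h4, max_eq_left hy0.le]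
        ring
    · have hxδ : x ∈ Ioo 0 δ := ⟨hx0, hx⟩
      have hb : 0 < (m - 1) / m * (x * w x) :=
        mul_pos hk (mul_pos hx0 (hwpos x ⟨hx0.le, hx.le⟩))
      have hJ : J x = φ x * slope (kernel m p σ ξ₀) w x := by
        rw [hφpos x hx0.le, ofPressure_mul_slope hm hp hσ hwc hwpos ⟨hx0, hx.le⟩,
          ← hφpos x hx0.le]
        refine congrArg _ (intervalIntegral.integral_congr fun y hy => ?_)
        rw [uIcc_of_le hx0.le] at hy
        simp only [k, hφpos y hy.1]
      have hexp : 1 / (m - 1) * m - 1 = 1 / (m - 1) := by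
        field_simp
        ring
      have hd := ((hderiv x hxδ).const_mul ((m - 1) / m)).rpow_const (p := 1 / (m - 1) * m)
        (Or.inl hb.ne')
      rw [hexp] at hd
      refine (hd.congr_of_eventuallyEq ?_).congr_deriv ?_
      · filter_upwards [Ioo_mem_nhds hx0 hx] with y hy
        have hwy := hwpos y ⟨hy.1.le, hy.2.le⟩
        have hy0 := hy.1
        rw [hφpos y hy.1.le, ofPressure, ← Real.rpow_mul (by positivity), mul_assoc]
      · rw [hJ, hφpos x hx0.le, ofPressure, mul_assoc ((m - 1) / m) x]
        field_simp
  have hpow' : ∀ ξ ∈ Ioi (ξ₀ - δ),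
      HasDerivAt (fun s => φ (ξ₀ - s) ^ m) (-J (ξ₀ - ξ)) ξ := fun ξ hξ =>
    (hpow (ξ₀ - ξ) (by rw [mem_Ioi] at hξ; linarith)).comp_const_sub ξ₀ ξ
  have hdpow : EqOn (deriv fun s => φ (ξ₀ - s) ^ m) (fun ξ => -J (ξ₀ - ξ)) (Ioi (ξ₀ - δ)) :=
    fun ξ hξ => (hpow' ξ hξ).deriv
  have hloc : ∀ ξ ∈ Ioi (ξ₀ - δ), 0 < φ (ξ₀ - ξ) → ξ₀ - ξ ∈ Ioo 0 δ := fun ξ hξ hpos => by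
    rw [mem_Ioi] at hξ
    refine ⟨lt_of_not_ge fun h => hpos.ne' (hφneg _ h), by linarith⟩
  have hJd : ∀ ξ ∈ Ioi (ξ₀ - δ), 0 < φ (ξ₀ - ξ) →
      HasDerivAt (deriv fun s => φ (ξ₀ - s) ^ m)
        (-beta m p σ * φ (ξ₀ - ξ) + beta m p σ * ξ * deriv φ (ξ₀ - ξ) + k (ξ₀ - ξ)) ξ := by
    intro ξ hξ hpos
    have h1 := (((hasDerivAt_id (ξ₀ - ξ)).const_sub ξ₀).const_mul (beta m p σ)).mul
      (hφd _ (hloc ξ hξ hpos)).hasDerivAt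
    have h2 := ((h1.add (hkd (ξ₀ - ξ))).comp_const_sub ξ₀ ξ).neg
    refine (h2.congr_of_eventuallyEq ?_).congr_deriv ?_
    · filter_upwards [Ioi_mem_nhds (mem_Ioi.1 hξ)] with s hs
      exact hdpow hs
    · simp only [id]
      ring
  refine ⟨ξ₀ - δ, fun ξ => φ (ξ₀ - ξ), by linarith, by linarith, ?_, ?_⟩
  · refine ⟨fun ξ hξ => ?_, (hφc.comp (continuous_const.sub continuous_id)).continuousOn, ?_,
      fun ξ hξ hpos => ?_, fun ξ hξ hpos => (hJd ξ hξ hpos).differentiableAt,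
      fun ξ hξ hpos => ?_⟩
    · rcases le_or_gt (ξ₀ - ξ) 0 with h | h
      · exact (hφneg _ h).ge
      · exact (hφ0 _ ⟨h, by rw [mem_Ioi] at hξ; linarith⟩).le
    · rw [show (1 : WithTop ℕ∞) = 0 + 1 from (zero_add 1).symm,
        contDiffOn_succ_iff_deriv_of_isOpen isOpen_Ioi]
      refine ⟨fun ξ hξ => (hpow' ξ hξ).differentiableAt.differentiableWithinAt, by simp, ?_⟩
      rw [contDiffOn_zero]
      exact (hJc.comp (continuous_const.sub continuous_id)).neg.continuousOn.congr hdpow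
    · exact ((hφd _ (hloc ξ hξ hpos)).hasDerivAt.comp_const_sub ξ₀ ξ).differentiableAt
    · rw [(hJd ξ hξ hpos).deriv,
        ((hφd _ (hloc ξ hξ hpos)).hasDerivAt.comp_const_sub ξ₀ ξ).deriv]
      simp only [k, sub_sub_cancel]
      ring
  · refine ⟨⟨?_, ?_, δ, hδ, fun ξ hξ => hφ0 _ ⟨by linarith [hξ.2], by linarith [hξ.1]⟩⟩,
      ((m - 1) / m * w 0) ^ (1 / (m - 1)), ?_, ?_⟩
    · simp [hφneg 0 le_rfl]
    · have := hpow' ξ₀ (by rw [mem_Ioi]; linarith)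
      rwa [sub_self, hJ0 0 le_rfl, neg_zero] at this
    · exact Real.rpow_pos_of_pos (mul_pos hk (hwpos 0 ⟨le_rfl, hδ.le⟩)) _
    · have hC : 0 < (m - 1) / m * w 0 := mul_pos hk (hwpos 0 ⟨le_rfl, hδ.le⟩)
      refine (Asymptotics.isEquivalent_iff_tendsto_one ?_).2 ?_
      · filter_upwards [self_mem_nhdsWithin] with ξ hξ
        exact (mul_pos (Real.rpow_pos_of_pos hC _)
          (Real.rpow_pos_of_pos (sub_pos.2 hξ) _)).ne'
      · have hlim : Tendsto (fun ξ => ((m - 1) / m * w (ξ₀ - ξ)) ^ (1 / (m - 1))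
            / ((m - 1) / m * w 0) ^ (1 / (m - 1))) (𝓝[<] ξ₀) (𝓝 1) := by
          have hcont : Continuous fun ξ => ((m - 1) / m * w (ξ₀ - ξ)) ^ (1 / (m - 1))
              / ((m - 1) / m * w 0) ^ (1 / (m - 1)) :=
            ((continuous_const.mul (hwc.comp (continuous_const.sub continuous_id))).rpow_const
              fun _ => Or.inr hq.le).div_const _
          have := hcont.tendsto ξ₀
          rw [sub_self, div_self (Real.rpow_pos_of_pos hC _).ne'] at this
          exact this.mono_left nhdsWithin_le_nhds
        refine hlim.congr' ?_
        filter_upwards [Ioo_mem_nhdsLT (by linarith : ξ₀ - δ < ξ₀)] with ξ hξ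
        have hx : 0 < ξ₀ - ξ := sub_pos.2 hξ.2
        have hw' := hwpos (ξ₀ - ξ) ⟨hx.le, by linarith [hξ.1]⟩
        rw [Pi.div_apply, hφpos _ hx.le, ofPressure, mul_right_comm,
          Real.mul_rpow (by positivity) hx.le]
        exact (mul_div_mul_right _ _ (Real.rpow_pos_of_pos hx _).ne').symm

end Existence

/-! ### Uniqueness and gluing -/

section Uniqueness

variable {m p σ a b ξ₀ : ℝ} {f g : ℝ → ℝ}

theorem exists_pos_bounds {u : ℝ → ℝ} {δ : ℝ} (hδ : 0 ≤ δ) (hu : Continuous u)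
    (hpos : ∀ x ∈ Icc 0 δ, 0 < u x) : ∃ lo > 0, ∃ hi, ∀ x ∈ Icc 0 δ, u x ∈ Icc lo hi := by
  obtain ⟨x₀, hx₀, hmin⟩ := isCompact_Icc.exists_isMinOn (nonempty_Icc.2 hδ) hu.continuousOn
  obtain ⟨x₁, -, hmax⟩ := isCompact_Icc.exists_isMaxOn (nonempty_Icc.2 hδ) hu.continuousOn
  exact ⟨u x₀, hpos _ hx₀, u x₁, fun x hx => ⟨hmin hx, hmax hx⟩⟩

/-- Two profiles with an interface of Type I at the same point have the same rescaled pressure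
near it, since both rescaled pressures are fixed points of one contraction. -/
theorem IsProfile.exists_eqOn_Icc_interface (hm : 1 < m) (hp : 0 < p) (hp1 : p < 1)
    (hmp : 2 < m + p) (hσ : 0 < σ) (hβ : 0 < beta m p σ) (hξ₀ : 0 < ξ₀)
    (hf : IsProfile m p σ b f) (hg : IsProfile m p σ b g) (hb : 0 ≤ b) (hbξ : b < ξ₀)
    (hfI : HasTypeIInterface m f ξ₀) (hgI : HasTypeIInterface m g ξ₀) :
    ∃ δ > 0, δ < ξ₀ - b ∧ EqOn f g (Icc (ξ₀ - δ) ξ₀) := by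
  obtain ⟨δ, hδ, hδb⟩ := exists_between (sub_pos.2 hbξ)
  obtain ⟨u, huc, hupos, hfu, hu⟩ :=
    hf.exists_rescaledPressure hm hp hp1 hmp hσ hβ hb hfI hδ hδb
  obtain ⟨v, hvc, hvpos, hgv, hv⟩ :=
    hg.exists_rescaledPressure hm hp hp1 hmp hσ hβ hb hgI hδ hδb
  obtain ⟨lo₁, hlo₁, hi₁, h₁⟩ := exists_pos_bounds hδ.le huc hupos
  obtain ⟨lo₂, hlo₂, hi₂, h₂⟩ := exists_pos_bounds hδ.le hvc hvpos
  have hlo : 0 < min lo₁ lo₂ := lt_min hlo₁ hlo₂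
  have hmu : ∀ x ∈ Icc 0 δ, u x ∈ Icc (min lo₁ lo₂) (max hi₁ hi₂) := fun x hx =>
    Icc_subset_Icc (min_le_left _ _) (le_max_left _ _) (h₁ x hx)
  have hmv : ∀ x ∈ Icc 0 δ, v x ∈ Icc (min lo₁ lo₂) (max hi₁ hi₂) := fun x hx =>
    Icc_subset_Icc (min_le_right _ _) (le_max_right _ _) (h₂ x hx)
  have hle : min lo₁ lo₂ ≤ max hi₁ hi₂ :=
    (hmu 0 ⟨le_rfl, hδ.le⟩).1.trans (hmu 0 ⟨le_rfl, hδ.le⟩).2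
  obtain ⟨δ₀, hδ₀, -, hest⟩ :=
    exists_kernel_estimates (hi := max hi₁ hi₂) hm hp hmp hσ hξ₀ hlo one_pos
  have hmin : 0 < min δ δ₀ := lt_min hδ hδ₀
  have heq : EqOn u v (Icc 0 (min δ δ₀)) :=
    eqOn_of_eq_meanSlope (continuous_truncKernel (ξ₀ := ξ₀) hm hp hmp hσ hlo hle) hmin.le
      (fun y hy t ht A A' B B' D hAD hBD =>
        (hest y ⟨hy.1, hy.2.trans (min_le_right _ _)⟩ t ht _ (truncate_mem hle A) _
          (truncate_mem hle B)).2 _ (truncate_mem hle A') _ (truncate_mem hle B') D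
          ((abs_truncate_sub_le _ _ _ _).trans hAD) ((abs_truncate_sub_le _ _ _ _).trans hBD))
      huc hvc (fun x hx => hu _ _ hlo hmu x ⟨hx.1, hx.2.trans (min_le_left _ _)⟩)
      (fun x hx => hv _ _ hlo hmv x ⟨hx.1, hx.2.trans (min_le_left _ _)⟩)
  refine ⟨min δ δ₀, hmin, (min_le_left _ _).trans_lt hδb, fun ξ hξ => ?_⟩
  have hx : ξ₀ - ξ ∈ Icc 0 (min δ δ₀) := ⟨by linarith [hξ.2], by linarith [hξ.1]⟩
  have hx' : ξ₀ - ξ ∈ Icc 0 δ := ⟨hx.1, hx.2.trans (min_le_left _ _)⟩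
  rw [← sub_sub_cancel ξ₀ ξ, hfu _ hx', hgv _ hx', heq hx]

/-- Two profiles on the same half-line with an interface of Type I at the same point coincide: near
the interface by contraction, further left by regular uniqueness, to the right because they
vanish. -/
theorem IsProfile.eqOn_Ioi (hm : 1 < m) (hp : 0 < p) (hp1 : p < 1)
    (hmp : 2 < m + p) (hσ : 0 < σ) (hβ : 0 < beta m p σ) (hξ₀ : 0 < ξ₀)
    (hf : IsProfile m p σ b f) (hg : IsProfile m p σ b g) (hb : 0 ≤ b) (hbξ : b < ξ₀)
    (hfI : HasTypeIInterface m f ξ₀) (hgI : HasTypeIInterface m g ξ₀) : EqOn f g (Ioi b) := by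
  obtain ⟨δ, hδ, hδb, heq⟩ :=
    hf.exists_eqOn_Icc_interface hm hp hp1 hmp hσ hβ hξ₀ hg hb hbξ hfI hgI
  intro ξ hξ
  have hξ : b < ξ := hξ
  rcases le_or_gt ξ₀ ξ with h | h
  · rw [hf.eq_zero_of_le hm hp hp1 hσ hβ hb hbξ hfI.hasInterface.eq_zero h,
      hg.eq_zero_of_le hm hp hp1 hσ hβ hb hbξ hgI.hasInterface.eq_zero h]
  rcases le_or_gt (ξ₀ - δ / 2) ξ with h' | h'
  · exact heq ⟨by linarith, h.le⟩
  have hpos (u : ℝ → ℝ) (hu : IsProfile m p σ b u) (hI : HasTypeIInterface m u ξ₀) :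
      ∀ x ∈ Icc ξ (ξ₀ - δ / 2), 0 < u x := fun x hx =>
    hu.pos_of_lt_interface hm hp hp1 hσ hβ hb hI.hasInterface
      ⟨hξ.trans_le hx.1, by linarith [hx.2]⟩
  refine hf.eqOn_Icc hm hg hb hξ h'.le (hpos f hf hfI) (hpos g hg hgI) ?_ ⟨le_rfl, h'.le⟩
  filter_upwards [Icc_mem_nhds (by linarith : ξ₀ - δ < ξ₀ - δ / 2)
    (by linarith : ξ₀ - δ / 2 < ξ₀)] with x hx
  exact heq hx

/-- Being a profile is a local property. -/
theorem isProfile_of_forall_exists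
    (h : ∀ ξ ∈ Ioi a, ∃ b < ξ, ∃ g, IsProfile m p σ b g ∧ EqOn f g (Ioi b)) :
    IsProfile m p σ a f := by
  have hev : ∀ {b ξ : ℝ} {g : ℝ → ℝ}, b < ξ → EqOn f g (Ioi b) → f =ᶠ[𝓝 ξ] g :=
    fun hb heq => heq.eventuallyEq_of_mem (Ioi_mem_nhds hb)
  have hevpow : ∀ {b ξ : ℝ} {g : ℝ → ℝ}, b < ξ → EqOn f g (Ioi b) →
      (fun s => f s ^ m) =ᶠ[𝓝 ξ] fun s => g s ^ m :=
    fun hb heq => (hev hb heq).mono fun s hs => by simp only [hs]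
  refine ⟨fun ξ hξ => ?_, fun ξ hξ => ?_, fun ξ hξ => ?_, fun ξ hξ hpos => ?_,
    fun ξ hξ hpos => ?_, fun ξ hξ hpos => ?_⟩ <;>
  obtain ⟨b, hb, g, hg, heq⟩ := h ξ hξ
  · rw [heq hb]
    exact hg.nonneg ξ hb
  · exact ((hg.continuousOn.continuousAt (Ioi_mem_nhds hb)).congr
      (hev hb heq).symm).continuousWithinAt
  · exact ((hg.contDiffOn_pow.contDiffAt (Ioi_mem_nhds hb)).congr_of_eventuallyEq
      (hevpow hb heq)).contDiffWithinAt
  · rw [heq hb] at hpos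
    exact (hg.differentiableAt ξ hb hpos).congr_of_eventuallyEq (hev hb heq)
  · rw [heq hb] at hpos
    exact (hg.differentiableAt_flux ξ hb hpos).congr_of_eventuallyEq (hevpow hb heq).deriv
  · rw [heq hb] at hpos ⊢
    rw [(hevpow hb heq).deriv.deriv_eq, (hev hb heq).deriv_eq]
    exact hg.equation ξ hb hpos

theorem HasTypeIInterface.congr (hI : HasTypeIInterface m g ξ₀) (h : f =ᶠ[𝓝 ξ₀] g) :
    HasTypeIInterface m f ξ₀ := by
  obtain ⟨C, hC, hequiv⟩ := hI.behavior
  obtain ⟨δ, hδ, hpos⟩ := hI.hasInterface.pos_left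
  obtain ⟨r, hr, hball⟩ := Metric.eventually_nhds_iff.1 h
  refine ⟨⟨h.eq_of_nhds.trans hI.hasInterface.eq_zero,
    hI.hasInterface.flux_eq_zero.congr_of_eventuallyEq (h.mono fun s hs => by simp only [hs]),
    min δ r, lt_min hδ hr, fun ξ hξ => ?_⟩, C, hC, ?_⟩
  · have h1 := min_le_left δ r
    have h2 := min_le_right δ r
    rw [hball (by
      rw [Real.dist_eq, abs_sub_comm, abs_of_pos (sub_pos.2 hξ.2)]
      linarith [hξ.1])]
    exact hpos ξ ⟨by linarith [hξ.1], hξ.2⟩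
  · exact hequiv.congr_left (h.symm.filter_mono nhdsWithin_le_nhds)

end Uniqueness

end BlowUpProfile

end

theorem proposition3p7 (m p σ : ℝ) (hm : 1 < m) (hp0 : 0 < p) (hp1 : p < 1)
    (hmp : 2 < m + p) (hσ : 2 * (1 - p) / (m - 1) < σ) (ξ₀ : ℝ) (hξ₀ : 0 < ξ₀) :
    ∃ (a : ℝ) (f : ℝ → ℝ), 0 ≤ a ∧ a < ξ₀ ∧
      BlowUpProfile.IsProfile m p σ a f ∧ BlowUpProfile.HasTypeIInterface m f ξ₀ ∧
      ∀ (b : ℝ) (g : ℝ → ℝ), 0 ≤ b → b < ξ₀ →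
        BlowUpProfile.IsProfile m p σ b g → BlowUpProfile.HasTypeIInterface m g ξ₀ →
          a ≤ b ∧ Set.EqOn g f (Set.Ioi b) := by
  have hm1 : 0 < m - 1 := by linarith
  have hσ0 : 0 < σ := (div_pos (by linarith) hm1).trans hσ
  have hβ : 0 < BlowUpProfile.beta m p σ := by
    rw [div_lt_iff₀ hm1] at hσ
    exact div_pos (by linarith) (by linarith)
  let Q : ℝ → (ℝ → ℝ) → Prop := fun b g =>
    0 ≤ b ∧ b < ξ₀ ∧ BlowUpProfile.IsProfile m p σ b g ∧ BlowUpProfile.HasTypeIInterface m g ξ₀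
  have hcompat : ∀ {b b' : ℝ} {g g' : ℝ → ℝ}, Q b g → Q b' g' → ∀ ξ, b < ξ → b' < ξ →
      g ξ = g' ξ := by
    intro b b' g g' h h' ξ hξ hξ'
    exact (h.2.2.1.mono (le_max_left b b')).eqOn_Ioi hm hp0 hp1 hmp hσ0 hβ hξ₀
      (h'.2.2.1.mono (le_max_right b b')) (h.1.trans (le_max_left _ _)) (max_lt h.2.1 h'.2.1)
      h.2.2.2 h'.2.2.2 (max_lt hξ hξ')
  let S : Set ℝ := {b | ∃ g, Q b g}
  obtain ⟨b₀, g₀, h₀⟩ := BlowUpProfile.exists_isProfile hm hp0 hmp hσ0 hβ hξ₀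
  have hS : S.Nonempty := ⟨b₀, g₀, h₀⟩
  have hSb : BddBelow S := ⟨0, fun b ⟨_, h⟩ => h.1⟩
  classical
  -- the union of all profiles with an interface of Type I at `ξ₀`
  let f : ℝ → ℝ := fun ξ => if h : ∃ g, ∃ b < ξ, Q b g then h.choose ξ else 0
  have hf : ∀ {b : ℝ} {g : ℝ → ℝ}, Q b g → Set.EqOn f g (Set.Ioi b) := by
    intro b g hg ξ hξ
    have h : ∃ g, ∃ b < ξ, Q b g := ⟨g, b, hξ, hg⟩
    obtain ⟨b', hb', hQ⟩ := h.choose_spec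
    simp only [f, dif_pos h]
    exact hcompat hQ hg ξ hb' hξ
  refine ⟨sInf S, f, le_csInf hS fun b ⟨_, h⟩ => h.1, (csInf_le hSb ⟨g₀, h₀⟩).trans_lt h₀.2.1,
    BlowUpProfile.isProfile_of_forall_exists fun ξ hξ => ?_,
    h₀.2.2.2.congr ((hf h₀).eventuallyEq_of_mem (Ioi_mem_nhds h₀.2.1)),
    fun b g hb0 hb hg hI => ?_⟩
  · obtain ⟨b, ⟨g, hg⟩, hb⟩ := exists_lt_of_csInf_lt hS hξ
    exact ⟨b, hb, g, hg.2.2.1, hf hg⟩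
  · exact ⟨csInf_le hSb ⟨g, hb0, hb, hg, hI⟩, (hf ⟨hb0, hb, hg, hI⟩).symm⟩
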